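/- Fix a real number $\gamma\ge0$. For real $N\ge0$ and $f:[0,1]\to\mathbb C$ let $$T_Nf(t)=\int_0^1 e^{iN/(1+t+s)}\,\frac{f(s)}{(1+t+s)^{\gamma}}\,ds,\qquad t\in[0,1].$$ For all $p,q\in[1,\infty]$ this is a well-defined operator from $L^p([0,1];\mathbb C)$ to $L^q([0,1];\mathbb C)$ (the integral converges absolutely for every $t\in[0,1]$ and $T_Nf\in L^q$). Let $$C_N(p\to q)=\sup_{f\in L^p\setminus\{0\}}\frac{\|T_Nf\|_{L^q}}{\|f\|_{L^p}}$$ be its norm. With the convention $1/\infty=0$, divide the unit square of the points $(1/p,1/q)$ into the regions - $\mathcal A$: $\ \tfrac12\le\tfrac1p\le1$ and $1-\tfrac1p\le\tfrac1q\le1$; - $\mathcal B$: $\ 0\le\tfrac1q\le\tfrac12$ and $0\le\tfrac1p\le1-\tfrac1q$; - $\mathcal C$: $\ 0\le\tfrac1p\le\tfrac12$ and $\tfrac12\le\tfrac1q\le1$. Then there exist positive constants $c_{\mathcal A},c_{\mathcal B},c_{\mathcal C}$, depending only on $\gamma$ (not on $N$, $p$, $q$), such that for all $N\ge0$ and all $p,q\in[1,\infty]$: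 - if $(1/p,1/q)\in\mathcal A$, then $c_{\mathcal A}^{-1}(1+N)^{-1+1/p}\le C_N(p\to q)\le c_{\mathcal A}(1+N)^{-1+1/p}$; - if $(1/p,1/q)\in\mathcal B$, then $c_{\mathcal B}^{-1}(1+N)^{-1/q}\le C_N(p\to q)\le c_{\mathcal B}(1+N)^{-1/q}$; - if $(1/p,1/q)\in\mathcal C$, then $c_{\mathcal C}^{-1}(1+N)^{-1/2}\le C_N(p\to q)\le c_{\mathcal C}(1+N)^{-1/2}$. In particular, there is a constant $c>0$ depending only on $\gamma$ such that for all $N\ge0$ and all $p,q\in[1,\infty]$ $$C_N(p\to q)\le c\,(1+N)^{-\min\{1-1/p,\;1/q,\;1/2\}}.$$ -/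

import Mathlib

open MeasureTheory Set
open scoped ENNReal

noncomputable section

/-- Lebesgue measure on the unit interval `[0,1]`. -/
def unitMeasure : Measure ℝ := volume.restrict (Icc (0 : ℝ) 1)

/-- The oscillating kernel `e^{iN/(1+t+s)} (1+t+s)^{-γ}`. -/
def oscKernel (γ N t s : ℝ) : ℂ :=
  Complex.exp (Complex.I * ((N / (1 + t + s) : ℝ) : ℂ)) / (((1 + t + s) ^ γ : ℝ) : ℂ)

/-- The integral operator `T_N f(t) = ∫₀¹ e^{iN/(1+t+s)} f(s) (1+t+s)^{-γ} ds`. -/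
def oscOp (γ N : ℝ) (f : ℝ → ℂ) (t : ℝ) : ℂ :=
  ∫ s, oscKernel γ N t s * f s ∂unitMeasure

/-- The best constant `C_N(p → q)`: the supremum, in `[0,∞]`, of `‖T_N f‖_{L^q} / ‖f‖_{L^p}` over
the functions `f ∈ L^p([0,1]; ℂ)` that are not almost everywhere zero. -/
def bestConst (γ N : ℝ) (p q : ℝ≥0∞) : ℝ≥0∞ :=
  ⨆ (f : ℝ → ℂ) (_ : MemLp f p unitMeasure) (_ : ¬ f =ᵐ[unitMeasure] 0),
    eLpNorm (oscOp γ N f) q unitMeasure / eLpNorm f p unitMeasure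

/-- The real number `1/p` for an exponent `p ∈ [1,∞]`, with `1/∞ = 0`. -/
def recip (p : ℝ≥0∞) : ℝ := (p⁻¹).toReal

/-- The point `(p → q) = (1/p, 1/q)` of the unit square. -/
def expPoint (p q : ℝ≥0∞) : ℝ × ℝ := (recip p, recip q)

/-- `1/2 ≤ 1/p ≤ 1` and `1 - 1/p ≤ 1/q ≤ 1`. -/
def regionA : Set (ℝ × ℝ) := {z | 1 / 2 ≤ z.1 ∧ z.1 ≤ 1 ∧ 1 - z.1 ≤ z.2 ∧ z.2 ≤ 1}

/-- `0 ≤ 1/q ≤ 1/2` and `0 ≤ 1/p ≤ 1 - 1/q`. -/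
def regionB : Set (ℝ × ℝ) := {z | 0 ≤ z.2 ∧ z.2 ≤ 1 / 2 ∧ 0 ≤ z.1 ∧ z.1 ≤ 1 - z.2}

/-- `0 ≤ 1/p ≤ 1/2` and `1/2 ≤ 1/q ≤ 1`. -/
def regionC : Set (ℝ × ℝ) := {z | 0 ≤ z.1 ∧ z.1 ≤ 1 / 2 ∧ 1 / 2 ≤ z.2 ∧ z.2 ≤ 1}

end

/-! Upper bounds. On a probability space the `L^p` norms increase with the exponent, so raising `p`
or lowering `q` can only decrease the best constant. Everything therefore follows from the duality
line `L^p → L^{p'}`, `1 ≤ p ≤ 2`, with constant of order `(1+N)^{-1+1/p}`: region A lowers the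
target exponent, region B starts from the dual exponent of `q`, and region C starts from `L² → L²`.

On that line the bound interpolates between `p = 1`, where the kernel is at most `1` in modulus, and
`p = 2`. The case `p = 2` is a `T*T` argument. The kernel of `T*T`, computed with a weight in `t`,
is an oscillatory integral whose phase has `t`-derivative `N(s-s')` times a positive smooth
function. Two integrations by parts give the decay `(1+(N(s-s'))²)⁻¹`
(`exists_norm_integral_oscKernel_mul_conj_le`), and the Schur test then gives the squared norm
`O(1/N)`. The weight lives on the larger interval `[-1/2, 3/2]` and vanishes to second order at its
ends, so no boundary terms appear. The interpolation is Hadamard's three lines theorem applied to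
the bilinear form on simple functions (`norm_kernelForm_simpleFunc_le`), followed by density and
duality (`eLpNorm_conj_le`).

Lower bounds. Three test functions suffice, and each estimate is valid for all `p` and `q`. The
indicator of `[0, 1/(1+N)]` sees an almost constant phase, which gives `(1+N)^{-1+1/p}`. The
conjugate of the phase at `t = 0` removes the oscillation for `t ≤ 1/(1+N)`, which gives
`(1+N)^{-1/q}`. Signs on about `N` equal intervals give `(1+N)^{-1/2}`: averaged over all choices of
signs, `|T_N f(t)|` is at least a multiple of `N^{-1/2}` for every `t`, by a Khinchine inequality
obtained from second and fourth moments (`le_sum_norm_signedSum`). -/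

/-! ### Interpolation for bounded kernels on a probability space -/

section Interpolation

variable {α : Type*} [MeasurableSpace α]

/-- The bilinear form `(f, g) ↦ ∬ K(t,s) f(s) g(t)` of a kernel `K`. -/
noncomputable def kernelForm (μ : Measure α) (K : α → α → ℂ) (f g : α → ℂ) : ℂ :=
  ∫ z, K z.1 z.2 * (g z.1 * f z.2) ∂μ.prod μ

variable {μ : Measure α} {K : α → α → ℂ}

theorem integrable_kernelForm (hK : AEStronglyMeasurable (Function.uncurry K) (μ.prod μ))
    (hb : ∀ᵐ z ∂μ.prod μ, ‖K z.1 z.2‖ ≤ 1) {f g : α → ℂ} (hf : Integrable f μ)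
    (hg : Integrable g μ) :
    Integrable (fun z : α × α => K z.1 z.2 * (g z.1 * f z.2)) (μ.prod μ) :=
  (hg.mul_prod hf).bdd_mul hK hb

theorem kernelForm_sub_left (hK : AEStronglyMeasurable (Function.uncurry K) (μ.prod μ))
    (hb : ∀ᵐ z ∂μ.prod μ, ‖K z.1 z.2‖ ≤ 1) {f f' g : α → ℂ} (hf : Integrable f μ)
    (hf' : Integrable f' μ) (hg : Integrable g μ) :
    kernelForm μ K (f - f') g = kernelForm μ K f g - kernelForm μ K f' g := by
  unfold kernelForm
  rw [← integral_sub (integrable_kernelForm hK hb hf hg) (integrable_kernelForm hK hb hf' hg)]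
  congr 1; ext z; simp only [Pi.sub_apply]; ring

theorem kernelForm_sub_right (hK : AEStronglyMeasurable (Function.uncurry K) (μ.prod μ))
    (hb : ∀ᵐ z ∂μ.prod μ, ‖K z.1 z.2‖ ≤ 1) {f g g' : α → ℂ} (hf : Integrable f μ)
    (hg : Integrable g μ) (hg' : Integrable g' μ) :
    kernelForm μ K f (g - g') = kernelForm μ K f g - kernelForm μ K f g' := by
  unfold kernelForm
  rw [← integral_sub (integrable_kernelForm hK hb hf hg) (integrable_kernelForm hK hb hf hg')]
  congr 1; ext z; simp only [Pi.sub_apply]; ring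

variable [IsProbabilityMeasure μ]

theorem norm_kernelForm_le (hb : ∀ᵐ z ∂μ.prod μ, ‖K z.1 z.2‖ ≤ 1) {f g : α → ℂ}
    (hf : Integrable f μ) (hg : Integrable g μ) :
    ‖kernelForm μ K f g‖ ≤ (∫ x, ‖f x‖ ∂μ) * ∫ x, ‖g x‖ ∂μ := by
  rw [mul_comm, ← integral_prod_mul]
  refine norm_integral_le_of_norm_le (hg.norm.mul_prod hf.norm) ?_
  filter_upwards [hb] with z hz
  rw [norm_mul, norm_mul]
  exact mul_le_of_le_one_left (by positivity) hz

/-- The analytic family `a |a|^{p(1 - z/2) - 1}` through `a`. -/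
noncomputable def analyticTwist (p : ℝ) (z a : ℂ) : ℂ :=
  a * Complex.exp ((p * (1 - z / 2) - 1) * (Real.log ‖a‖ : ℝ))

theorem norm_analyticTwist_eq (p : ℝ) (z a : ℂ) :
    ‖analyticTwist p z a‖ = ‖a‖ * Real.exp ((p * (1 - z.re / 2) - 1) * Real.log ‖a‖) := by
  have hre : ((p * (1 - z / 2) - 1) * (Real.log ‖a‖ : ℝ) : ℂ).re
      = (p * (1 - z.re / 2) - 1) * Real.log ‖a‖ := by
    simp [Complex.mul_re]
  rw [analyticTwist, norm_mul, Complex.norm_exp, hre]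

theorem norm_analyticTwist {p : ℝ} {z : ℂ} (h : p * (1 - z.re / 2) ≠ 0) (a : ℂ) :
    ‖analyticTwist p z a‖ = ‖a‖ ^ (p * (1 - z.re / 2)) := by
  rcases eq_or_ne a 0 with rfl | ha
  · simp [analyticTwist, Real.zero_rpow h]
  · have hpos : 0 < ‖a‖ := norm_pos_iff.2 ha
    rw [norm_analyticTwist_eq, Real.rpow_def_of_pos hpos, mul_comm _ (Real.log _),
      mul_sub, mul_one, Real.exp_sub, Real.exp_log hpos, mul_div_cancel₀ _ hpos.ne']

theorem differentiable_analyticTwist (p : ℝ) (a : ℂ) :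
    Differentiable ℂ fun z => analyticTwist p z a := by
  unfold analyticTwist
  fun_prop

theorem norm_analyticTwist_le {p : ℝ} (hp : 0 ≤ p) {z : ℂ} (h0 : 0 ≤ z.re) (h1 : z.re ≤ 1) (a : ℂ) :
    ‖analyticTwist p z a‖ ≤ ‖a‖ * Real.exp ((p + 1) * |Real.log ‖a‖|) := by
  rw [norm_analyticTwist_eq]
  refine mul_le_mul_of_nonneg_left (Real.exp_le_exp.2 ?_) (norm_nonneg _)
  refine (le_abs_self _).trans ?_
  rw [abs_mul]
  refine mul_le_mul_of_nonneg_right ?_ (abs_nonneg _)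
  rw [abs_le]
  constructor <;> nlinarith

/-- Bilinearity reduces the form to a finite sum in which only the scalars `φ a`, `φ b` vary. With
`φ` the analytic twist, this makes the form entire in `z` and bounded on the strip. -/
theorem kernelForm_map_eq_sum (hK : AEStronglyMeasurable (Function.uncurry K) (μ.prod μ))
    (hb : ∀ᵐ z ∂μ.prod μ, ‖K z.1 z.2‖ ≤ 1) (f g : SimpleFunc α ℂ) (φ : ℂ → ℂ) :
    kernelForm μ K (f.map φ) (g.map φ) = ∑ b ∈ g.range, ∑ a ∈ f.range, φ b * φ a *
      kernelForm μ K ((f ⁻¹' {a}).indicator 1) ((g ⁻¹' {b}).indicator 1) := by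
  have key : ∀ (h : SimpleFunc α ℂ) (x : α),
      h.map φ x = ∑ a ∈ h.range, φ a * (h ⁻¹' {a}).indicator 1 x := by
    intro h x
    rw [Finset.sum_eq_single (h x)]
    · simp
    · intro b _ hbx
      simp [indicator, hbx.symm]
    · intro hx; exact absurd (SimpleFunc.mem_range_self h x) hx
  have hint : ∀ (h : SimpleFunc α ℂ) (a : ℂ),
      Integrable ((h ⁻¹' {a}).indicator (1 : α → ℂ)) μ := fun h a =>
    (integrable_const (1 : ℂ)).indicator (h.measurableSet_fiber a)
  unfold kernelForm
  simp_rw [key, Finset.sum_mul_sum, Finset.mul_sum]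
  rw [integral_finsetSum]
  · refine Finset.sum_congr rfl fun b _ => ?_
    rw [integral_finsetSum]
    · refine Finset.sum_congr rfl fun a _ => ?_
      rw [← integral_const_mul]
      congr 1; ext z; ring
    · intro a _
      refine ((integrable_kernelForm hK hb (hint f a) (hint g b)).const_mul (φ b * φ a)).congr ?_
      exact Filter.Eventually.of_forall fun z => by ring
  · intro b _
    refine integrable_finsetSum _ fun a _ => ?_
    refine ((integrable_kernelForm hK hb (hint f a) (hint g b)).const_mul (φ b * φ a)).congr ?_
    exact Filter.Eventually.of_forall fun z => by ring

open Complex.HadamardThreeLines in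
-- Three lines theorem: twisting both arguments turns `‖a‖` into `‖a‖^p` on `Re z = 0`, where the
-- `L¹ × L¹` bound applies, and into `‖a‖^{p/2}` on `Re z = 1`, where `h2` applies.
theorem norm_kernelForm_simpleFunc_le (hK : AEStronglyMeasurable (Function.uncurry K) (μ.prod μ))
    (hb : ∀ᵐ z ∂μ.prod μ, ‖K z.1 z.2‖ ≤ 1) {A : ℝ} (hA : 0 ≤ A)
    (h2 : ∀ f g : SimpleFunc α ℂ, ‖kernelForm μ K f g‖ ≤
      A * ((∫ x, ‖f x‖ ^ 2 ∂μ) ^ (1 / 2 : ℝ) * (∫ x, ‖g x‖ ^ 2 ∂μ) ^ (1 / 2 : ℝ)))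
    {p : ℝ} (hp1 : 1 ≤ p) (hp2 : p ≤ 2) (f g : SimpleFunc α ℂ) :
    ‖kernelForm μ K f g‖ ≤ A ^ (2 - 2 / p) *
      ((∫ x, ‖f x‖ ^ p ∂μ) ^ (1 / p) * (∫ x, ‖g x‖ ^ p ∂μ) ^ (1 / p)) := by
  have hp0 : 0 < p := by linarith
  have hinv1 : 1 / p ≤ 1 := by rw [div_le_one hp0]; exact hp1
  have hinv2 : 1 / 2 ≤ 1 / p := one_div_le_one_div_of_le hp0 hp2
  set F : ℂ → ℂ := fun z => kernelForm μ K (f.map (analyticTwist p z)) (g.map (analyticTwist p z))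
    with hF
  set u := ∫ x, ‖f x‖ ^ p ∂μ with hu
  set v := ∫ x, ‖g x‖ ^ p ∂μ with hv
  have hu0 : 0 ≤ u := integral_nonneg fun x => by positivity
  have hv0 : 0 ≤ v := integral_nonneg fun x => by positivity
  have hFsum : ∀ z, F z = ∑ b ∈ g.range, ∑ a ∈ f.range, analyticTwist p z b * analyticTwist p z a *
      kernelForm μ K ((f ⁻¹' {a}).indicator 1) ((g ⁻¹' {b}).indicator 1) :=
    fun z => kernelForm_map_eq_sum hK hb f g _
  have hd : Differentiable ℂ F := by
    rw [show F = _ from funext hFsum]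
    have := differentiable_analyticTwist p
    fun_prop
  have hint : ∀ h : SimpleFunc α ℂ, Integrable h μ := fun h =>
    SimpleFunc.integrable_of_isFiniteMeasure h
  have ha : ∀ z ∈ Complex.re ⁻¹' {(0 : ℝ)}, ‖F z‖ ≤ u * v := by
    intro z hz
    have hz : z.re = 0 := hz
    have hne : p * (1 - z.re / 2) ≠ 0 := by rw [hz]; simp; exact hp0.ne'
    refine (norm_kernelForm_le hb (hint _) (hint _)).trans (le_of_eq ?_)
    simp only [SimpleFunc.map_apply, norm_analyticTwist hne, hu, hv]
    simp [hz]
  have hb' : ∀ z ∈ Complex.re ⁻¹' {(1 : ℝ)}, ‖F z‖ ≤ A * (u ^ (1 / 2 : ℝ) * v ^ (1 / 2 : ℝ)) := by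
    intro z hz
    have hz : z.re = 1 := hz
    have hne : p * (1 - z.re / 2) ≠ 0 := by
      rw [hz]; have : p * (1 - 1 / 2) > 0 := by linarith
      exact this.ne'
    refine (h2 _ _).trans (le_of_eq ?_)
    have : ∀ a : ℂ, (‖a‖ ^ (p * (1 - 1 / 2))) ^ 2 = ‖a‖ ^ p := fun a => by
      rw [← Real.rpow_natCast, ← Real.rpow_mul (norm_nonneg _)]
      congr 1; push_cast; ring
    simp only [SimpleFunc.map_apply, norm_analyticTwist hne, hu, hv, hz, this]
  have hB : BddAbove ((norm ∘ F) '' verticalClosedStrip 0 1) := by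
    refine ⟨∑ b ∈ g.range, ∑ a ∈ f.range, (‖b‖ * Real.exp ((p + 1) * |Real.log ‖b‖|)) *
      (‖a‖ * Real.exp ((p + 1) * |Real.log ‖a‖|)) *
      ‖kernelForm μ K ((f ⁻¹' {a}).indicator 1) ((g ⁻¹' {b}).indicator 1)‖, ?_⟩
    rintro _ ⟨z, hz, rfl⟩
    simp only [Function.comp_apply, hFsum]
    refine (norm_sum_le _ _).trans (Finset.sum_le_sum fun b _ => ?_)
    refine (norm_sum_le _ _).trans (Finset.sum_le_sum fun a _ => ?_)
    rw [norm_mul, norm_mul]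
    have := fun a => norm_analyticTwist_le hp0.le hz.1 hz.2 a
    gcongr <;> apply this
  -- At `θ = 2 - 2/p` the exponent `p(1 - θ/2)` equals `1`, so the twist is the identity and the
  -- original form is recovered.
  have hθ : ((2 - 2 / p : ℝ) : ℂ) ∈ verticalClosedStrip 0 1 := by
    simp only [verticalClosedStrip, mem_preimage, Complex.ofReal_re, mem_Icc]
    have : 2 / p = 2 * (1 / p) := by ring
    constructor <;> linarith
  have key := norm_le_interp_of_mem_verticalClosedStrip' zero_lt_one hθ hd.diffContOnCl hB ha hb'
  have hFθ : F ((2 - 2 / p : ℝ) : ℂ) = kernelForm μ K f g := by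
    have : ∀ a, analyticTwist p ((2 - 2 / p : ℝ) : ℂ) a = a := by
      intro a
      have hp0' : (p : ℂ) ≠ 0 := by exact_mod_cast hp0.ne'
      have : (p * (1 - ((2 - 2 / p : ℝ) : ℂ) / 2) - 1 : ℂ) = 0 := by
        push_cast; field_simp; ring
      rw [analyticTwist, this]; simp
    simp only [hF]
    congr 1 <;> ext x <;> exact this _
  rw [hFθ] at key
  refine key.trans (le_of_eq ?_)
  simp only [Complex.ofReal_re, sub_zero, div_one]
  have e : ∀ y : ℝ, 0 ≤ y → y ^ (1 - (2 - 2 / p)) * (y ^ (1 / 2 : ℝ)) ^ (2 - 2 / p) = y ^ (1 / p) := by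
    intro y hy
    rw [← Real.rpow_mul hy, ← Real.rpow_add_of_nonneg hy]
    · congr 1; ring
    · have : 2 / p = 2 * (1 / p) := by ring
      linarith
    · have : 2 / p = 2 * (1 / p) := by ring
      linarith
  rw [Real.mul_rpow hu0 hv0, Real.mul_rpow hA (by positivity), Real.mul_rpow (by positivity) (by positivity),
    ← e u hu0, ← e v hv0]
  ring

theorem norm_kernelForm_le_eLpNorm (hb : ∀ᵐ z ∂μ.prod μ, ‖K z.1 z.2‖ ≤ 1) {P : ℝ≥0∞}
    (hP : 1 ≤ P) {f g : α → ℂ} (hf : MemLp f P μ) (hg : MemLp g P μ) :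
    ‖kernelForm μ K f g‖ ≤ (eLpNorm f P μ).toReal * (eLpNorm g P μ).toReal := by
  have key : ∀ {h : α → ℂ}, MemLp h P μ → ∫ x, ‖h x‖ ∂μ ≤ (eLpNorm h P μ).toReal := by
    intro h hh
    rw [integral_norm_eq_lintegral_enorm hh.1, ← eLpNorm_one_eq_lintegral_enorm]
    exact ENNReal.toReal_mono hh.2.ne (eLpNorm_le_eLpNorm_of_exponent_le hP hh.1)
  refine (norm_kernelForm_le hb (hf.integrable hP) (hg.integrable hP)).trans ?_
  exact mul_le_mul (key hf) (key hg) (integral_nonneg fun _ => norm_nonneg _)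
    ENNReal.toReal_nonneg

/-- Density of simple functions in `L^P`. The crude bound `norm_kernelForm_le_eLpNorm` makes the
form continuous there, so the error terms vanish in the limit while the constant `D` survives. -/
theorem norm_kernelForm_le_of_simpleFunc
    (hK : AEStronglyMeasurable (Function.uncurry K) (μ.prod μ))
    (hb : ∀ᵐ z ∂μ.prod μ, ‖K z.1 z.2‖ ≤ 1) {P : ℝ≥0∞} (hP : 1 ≤ P) (hP' : P ≠ ∞) {D : ℝ}
    (hD : 0 ≤ D) (h : ∀ f g : SimpleFunc α ℂ, ‖kernelForm μ K f g‖ ≤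
      D * ((eLpNorm f P μ).toReal * (eLpNorm g P μ).toReal))
    {f g : α → ℂ} (hf : MemLp f P μ) (hg : MemLp g P μ) :
    ‖kernelForm μ K f g‖ ≤ D * ((eLpNorm f P μ).toReal * (eLpNorm g P μ).toReal) := by
  set a := (eLpNorm f P μ).toReal
  set b := (eLpNorm g P μ).toReal
  have ha : 0 ≤ a := ENNReal.toReal_nonneg
  have hb0 : 0 ≤ b := ENNReal.toReal_nonneg
  have approx : ∀ {k : α → ℂ}, MemLp k P μ → ∀ e : ℝ, 0 < e → ∃ k' : SimpleFunc α ℂ,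
      MemLp k' P μ ∧ (eLpNorm (k - ⇑k') P μ).toReal ≤ e ∧
      (eLpNorm k' P μ).toReal ≤ (eLpNorm k P μ).toReal + e := by
    intro k hk e he
    obtain ⟨k', h1, h2⟩ := hk.exists_simpleFunc_eLpNorm_sub_lt hP' (ENNReal.ofReal_pos.2 he).ne'
    have h3 : (eLpNorm (k - ⇑k') P μ).toReal ≤ e :=
      ENNReal.toReal_le_of_le_ofReal he.le h1.le
    refine ⟨k', h2, h3, ?_⟩
    have h4 : eLpNorm k' P μ ≤ eLpNorm k P μ + eLpNorm (k - ⇑k') P μ := by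
      have := eLpNorm_sub_le hk.1 (hk.sub h2).1 hP
      rwa [sub_sub_cancel] at this
    refine (ENNReal.toReal_mono (ENNReal.add_ne_top.2 ⟨hk.2.ne, (hk.sub h2).2.ne⟩) h4).trans ?_
    rw [ENNReal.toReal_add hk.2.ne (hk.sub h2).2.ne]
    gcongr
  have main : ∀ e : ℝ, 0 < e →
      ‖kernelForm μ K f g‖ ≤ e * b + (a + e) * e + D * ((a + e) * (b + e)) := by
    intro e he
    obtain ⟨f', hf1, hf2, hf3⟩ := approx hf e he
    obtain ⟨g', hg1, hg2, hg3⟩ := approx hg e he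
    have e1 := kernelForm_sub_left hK hb (hf.integrable hP) (hf1.integrable hP) (hg.integrable hP)
    have e2 := kernelForm_sub_right hK hb (hf1.integrable hP) (hg.integrable hP)
      (hg1.integrable hP)
    have e3 : kernelForm μ K f g = kernelForm μ K (f - ⇑f') g + kernelForm μ K f' (g - ⇑g') +
        kernelForm μ K f' g' := by rw [e1, e2]; ring
    rw [e3]
    refine (norm_add₃_le).trans (add_le_add_three ?_ ?_ ?_)
    · refine (norm_kernelForm_le_eLpNorm hb hP (hf.sub hf1) hg).trans ?_
      gcongr
    · refine (norm_kernelForm_le_eLpNorm hb hP hf1 (hg.sub hg1)).trans ?_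
      gcongr
    · refine (h f' g').trans ?_
      gcongr
  have hlim : Filter.Tendsto (fun e : ℝ => e * b + (a + e) * e + D * ((a + e) * (b + e)))
      (nhdsWithin 0 (Ioi 0)) (nhds (0 * b + (a + 0) * 0 + D * ((a + 0) * (b + 0)))) := by
    refine Filter.Tendsto.mono_left (Continuous.tendsto ?_ 0) nhdsWithin_le_nhds
    fun_prop
  simp only [zero_mul, add_zero, mul_zero, zero_add] at hlim
  exact ge_of_tendsto hlim (eventually_nhdsWithin_of_forall fun e he => main e he)

/-- Converse Hölder inequality, by testing against the extremal function. The bound `C` makes the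
norm finite beforehand, so that one power of it can be cancelled; `2 ≤ q` keeps the exponent `q - 2`
nonnegative. -/
theorem eLpNorm_le_of_norm_integral_mul_le {h : α → ℂ} (hm : AEStronglyMeasurable h μ) {C : ℝ}
    (hC : ∀ᵐ x ∂μ, ‖h x‖ ≤ C) {p q : ℝ} (hpq : p.HolderConjugate q) (hq : 2 ≤ q) {D : ℝ}
    (hD : 0 ≤ D) (H : ∀ g : α → ℂ, MemLp g (ENNReal.ofReal p) μ →
      ‖∫ x, h x * g x ∂μ‖ ≤ D * (eLpNorm g (ENNReal.ofReal p) μ).toReal) :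
    eLpNorm h (ENNReal.ofReal q) μ ≤ ENNReal.ofReal D := by
  have hq0 : 0 < q := by linarith
  have hp0 : 0 < p := hpq.pos
  set g : α → ℂ := fun x => (starRingEnd ℂ) (h x) * ((‖h x‖ ^ (q - 2) : ℝ) : ℂ) with hg
  have hgn : ∀ x, ‖g x‖ ^ p = ‖h x‖ ^ q := by
    intro x
    have : ‖g x‖ = ‖h x‖ ^ (q - 1) := by
      rw [hg]
      simp only [norm_mul, RCLike.norm_conj, Complex.norm_real, Real.norm_eq_abs,
        abs_of_nonneg (Real.rpow_nonneg (norm_nonneg (h x)) (q - 2))]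
      rw [← Real.rpow_one_add' (norm_nonneg _) (by linarith)]
      congr 1; ring
    rw [this, ← Real.rpow_mul (norm_nonneg _), hpq.symm.sub_one_mul_conj]
  have hhg : ∀ x, h x * g x = ((‖h x‖ ^ q : ℝ) : ℂ) := by
    intro x
    rw [hg]
    simp only
    rw [← mul_assoc, Complex.mul_conj, ← Complex.ofReal_mul, Complex.normSq_eq_norm_sq,
      ← Real.rpow_natCast, ← Real.rpow_add_of_nonneg (norm_nonneg _) (by norm_num) (by linarith)]
    congr 2; push_cast; ring
  have hmemh : MemLp h (ENNReal.ofReal q) μ := MemLp.of_bound hm C hC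
  have hgm : AEStronglyMeasurable g μ := by
    refine (Complex.continuous_conj.comp_aestronglyMeasurable hm).mul
      (Complex.continuous_ofReal.comp_aestronglyMeasurable ?_)
    exact (Real.continuous_rpow_const (by linarith)).comp_aestronglyMeasurable hm.norm
  have hmemg : MemLp g (ENNReal.ofReal p) μ := by
    have hi : Integrable (fun x => ‖h x‖ ^ q) μ := by
      have := hmemh.integrable_norm_rpow (by simpa using hq0) ENNReal.ofReal_ne_top
      rwa [ENNReal.toReal_ofReal hq0.le] at this
    rw [← integrable_norm_rpow_iff hgm (by simpa using hp0) ENNReal.ofReal_ne_top,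
      ENNReal.toReal_ofReal hp0.le]
    simpa only [hgn] using hi
  set I := ∫ x, ‖h x‖ ^ q ∂μ with hI
  have hI0 : 0 ≤ I := integral_nonneg fun x => by positivity
  have key := H g hmemg
  rw [hmemg.eLpNorm_eq_integral_rpow_norm (by simpa using hp0) ENNReal.ofReal_ne_top] at key
  simp only [hhg, ENNReal.toReal_ofReal hp0.le, hgn] at key
  rw [integral_complex_ofReal, ← hI, Complex.norm_real, Real.norm_of_nonneg hI0,
    ENNReal.toReal_ofReal (by positivity)] at key
  rw [hmemh.eLpNorm_eq_integral_rpow_norm (by simpa using hq0) ENNReal.ofReal_ne_top,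
    ENNReal.toReal_ofReal hq0.le, ← hI]
  refine ENNReal.ofReal_le_ofReal ?_
  -- The test gives `I ≤ D I^{1/p}`; dividing by `I^{1/p}` leaves `I^{1/q} ≤ D`.
  rcases hI0.eq_or_lt with h0 | hpos
  · rw [← h0, Real.zero_rpow (by positivity)]; exact hD
  · have e : I = I ^ p⁻¹ * I ^ q⁻¹ := by
      rw [← Real.rpow_add hpos, hpq.inv_add_inv_eq_one, Real.rpow_one]
    have hpp : 0 < I ^ p⁻¹ := by positivity
    refine le_of_mul_le_mul_left ?_ hpp
    rw [← e, mul_comm]; exact key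

theorem eLpNorm_conj_le (hK : AEStronglyMeasurable (Function.uncurry K) (μ.prod μ))
    (hb : ∀ᵐ z ∂μ.prod μ, ‖K z.1 z.2‖ ≤ 1) {A : ℝ} (hA : 0 ≤ A)
    (h2 : ∀ f g : SimpleFunc α ℂ, ‖kernelForm μ K f g‖ ≤
      A * ((∫ x, ‖f x‖ ^ 2 ∂μ) ^ (1 / 2 : ℝ) * (∫ x, ‖g x‖ ^ 2 ∂μ) ^ (1 / 2 : ℝ)))
    {p q : ℝ} (hpq : p.HolderConjugate q) (hp2 : p ≤ 2) {f : α → ℂ}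
    (hf : MemLp f (ENNReal.ofReal p) μ)
    (hm : AEStronglyMeasurable (fun t => ∫ s, K t s * f s ∂μ) μ) {C : ℝ}
    (hC : ∀ᵐ t ∂μ, ‖∫ s, K t s * f s ∂μ‖ ≤ C) :
    eLpNorm (fun t => ∫ s, K t s * f s ∂μ) (ENNReal.ofReal q) μ ≤
      ENNReal.ofReal (A ^ (2 - 2 / p)) * eLpNorm f (ENNReal.ofReal p) μ := by
  have hp0 : 0 < p := hpq.pos
  have hp1 : 1 ≤ p := hpq.lt.le
  have hP : 1 ≤ ENNReal.ofReal p := by simpa using hp1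
  have hq : 2 ≤ q := by
    have h1 := hpq.inv_add_inv_eq_one
    have h3 : (2 : ℝ)⁻¹ ≤ p⁻¹ := inv_anti₀ hp0 hp2
    exact (inv_le_inv₀ hpq.symm.pos two_pos).1 (by linarith)
  have hnorm : ∀ k : SimpleFunc α ℂ, (eLpNorm k (ENNReal.ofReal p) μ).toReal =
      (∫ x, ‖k x‖ ^ p ∂μ) ^ (1 / p) := by
    intro k
    rw [(SimpleFunc.memLp_of_isFiniteMeasure k _ μ).eLpNorm_eq_integral_rpow_norm (by simpa using hp0)
      ENNReal.ofReal_ne_top, ENNReal.toReal_ofReal hp0.le, ENNReal.toReal_ofReal (by positivity),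
      one_div]
  have hAp : 0 ≤ A ^ (2 - 2 / p) := by positivity
  rw [← ENNReal.ofReal_toReal hf.2.ne, ← ENNReal.ofReal_mul hAp]
  refine eLpNorm_le_of_norm_integral_mul_le hm hC hpq hq (by positivity) fun g hg => ?_
  have hB := norm_kernelForm_le_of_simpleFunc hK hb hP ENNReal.ofReal_ne_top hAp
    (fun f g => by
      rw [hnorm, hnorm]; exact norm_kernelForm_simpleFunc_le hK hb hA h2 hp1 hp2 f g) hf hg
  rw [kernelForm, integral_prod _ (integrable_kernelForm hK hb (hf.integrable hP)
    (hg.integrable hP))] at hB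
  refine le_trans (le_of_eq ?_) (hB.trans (le_of_eq (by ring)))
  congr 2; ext t
  rw [← integral_mul_const]
  congr 1; ext s; ring

end Interpolation

/-! ### Elementary bounds and measurability for the kernel and the operator -/

instance : IsProbabilityMeasure unitMeasure :=
  ⟨by simp [unitMeasure]⟩

theorem measurable_oscKernel (γ N : ℝ) :
    Measurable (Function.uncurry (oscKernel γ N)) := by
  unfold Function.uncurry oscKernel
  fun_prop

theorem norm_oscKernel {γ N t s : ℝ} (h : 0 ≤ 1 + t + s) :
    ‖oscKernel γ N t s‖ = ((1 + t + s) ^ γ)⁻¹ := by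
  rw [oscKernel, norm_div, mul_comm, Complex.norm_exp_ofReal_mul_I, Complex.norm_real,
    Real.norm_of_nonneg (Real.rpow_nonneg h γ), one_div]

theorem norm_oscKernel_le_one {γ N t s : ℝ} (hγ : 0 ≤ γ) (ht : 0 ≤ t) (hs : 0 ≤ s) :
    ‖oscKernel γ N t s‖ ≤ 1 := by
  rw [norm_oscKernel (by linarith)]
  exact inv_le_one_of_one_le₀ (Real.one_le_rpow (by linarith) hγ)

theorem ae_unitMeasure_mem : ∀ᵐ s ∂unitMeasure, s ∈ Icc (0 : ℝ) 1 :=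
  ae_restrict_mem measurableSet_Icc

theorem ae_unitMeasure_prod_mem :
    ∀ᵐ z ∂unitMeasure.prod unitMeasure, z ∈ Icc (0 : ℝ) 1 ×ˢ Icc (0 : ℝ) 1 := by
  rw [unitMeasure, Measure.prod_restrict]
  exact ae_restrict_mem (measurableSet_Icc.prod measurableSet_Icc)

section

variable {γ N : ℝ} (hγ : 0 ≤ γ)

include hγ

theorem ae_norm_oscKernel_le_one :
    ∀ᵐ z ∂unitMeasure.prod unitMeasure, ‖oscKernel γ N z.1 z.2‖ ≤ 1 := by
  filter_upwards [ae_unitMeasure_prod_mem] with z hz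
  exact norm_oscKernel_le_one hγ hz.1.1 hz.2.1

theorem integrable_oscKernel_mul {f : ℝ → ℂ} (hf : Integrable f unitMeasure) {t : ℝ}
    (ht : 0 ≤ t) : Integrable (fun s => oscKernel γ N t s * f s) unitMeasure := by
  refine hf.bdd_mul (c := 1) ?_ ?_
  · exact ((measurable_oscKernel γ N).comp measurable_prodMk_left).aestronglyMeasurable
  · filter_upwards [ae_unitMeasure_mem] with s hs
    exact norm_oscKernel_le_one hγ ht hs.1

theorem norm_oscOp_le {f : ℝ → ℂ} (hf : Integrable f unitMeasure) {t : ℝ} (ht : 0 ≤ t) :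
    ‖oscOp γ N f t‖ ≤ ∫ s, ‖f s‖ ∂unitMeasure := by
  refine norm_integral_le_of_norm_le hf.norm ?_
  filter_upwards [ae_unitMeasure_mem] with s hs
  rw [norm_mul]
  exact mul_le_of_le_one_left (norm_nonneg _) (norm_oscKernel_le_one hγ ht hs.1)

theorem ae_norm_oscOp_le {f : ℝ → ℂ} (hf : Integrable f unitMeasure) :
    ∀ᵐ t ∂unitMeasure, ‖oscOp γ N f t‖ ≤ ∫ s, ‖f s‖ ∂unitMeasure := by
  filter_upwards [ae_unitMeasure_mem] with t ht
  exact norm_oscOp_le hγ hf ht.1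

omit hγ in
theorem stronglyMeasurable_oscOp {f : ℝ → ℂ} (hf : AEStronglyMeasurable f unitMeasure) :
    StronglyMeasurable (oscOp γ N f) := by
  have h : oscOp γ N f = oscOp γ N (hf.mk f) := by
    ext t
    refine integral_congr_ae ?_
    filter_upwards [hf.ae_eq_mk] with s hs
    rw [hs]
  rw [h]
  refine StronglyMeasurable.integral_prod_right'
    (f := fun z : ℝ × ℝ => oscKernel γ N z.1 z.2 * hf.mk f z.2) ?_
  exact (measurable_oscKernel γ N).stronglyMeasurable.mul
    (hf.stronglyMeasurable_mk.comp_measurable measurable_snd)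

theorem memLp_oscOp {f : ℝ → ℂ} (hf : Integrable f unitMeasure) (q : ℝ≥0∞) :
    MemLp (oscOp γ N f) q unitMeasure :=
  MemLp.of_bound (stronglyMeasurable_oscOp hf.1).aestronglyMeasurable _ (ae_norm_oscOp_le hγ hf)

end

/-! ### Decay of the kernel of `T*T` by two integrations by parts -/

/-- The derivative of `E B` integrates to zero because `B` vanishes at both ends. Writing an
amplitude as `h B`, with `c h` the derivative of the phase, trades it for `B'` and gains a factor
`1/c`. -/
theorem integral_oscillating_by_parts {a b c : ℝ} (hab : a ≤ b) {E : ℝ → ℂ} {h B B' : ℝ → ℝ}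
    (hE : ∀ t ∈ Icc a b, HasDerivAt E (Complex.I * ((c * h t : ℝ) : ℂ) * E t) t)
    (hB : ∀ t ∈ Icc a b, HasDerivAt B (B' t) t) (hh : ContinuousOn h (Icc a b))
    (hB' : ContinuousOn B' (Icc a b)) (ha : B a = 0) (hb : B b = 0) :
    Complex.I * c * ∫ t in a..b, E t * ((h t * B t : ℝ) : ℂ) =
      -∫ t in a..b, E t * ((B' t : ℝ) : ℂ) := by
  have hEc : ContinuousOn E (Icc a b) := fun t ht => (hE t ht).continuousAt.continuousWithinAt
  have hBc : ContinuousOn B (Icc a b) := fun t ht => (hB t ht).continuousAt.continuousWithinAt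
  have i1 : IntervalIntegrable (fun t => Complex.I * c * (E t * ((h t * B t : ℝ) : ℂ))) volume a b := by
    refine ContinuousOn.intervalIntegrable_of_Icc hab ?_
    exact continuousOn_const.mul (hEc.mul (Complex.continuous_ofReal.comp_continuousOn (hh.mul hBc)))
  have i2 : IntervalIntegrable (fun t => E t * ((B' t : ℝ) : ℂ)) volume a b := by
    refine ContinuousOn.intervalIntegrable_of_Icc hab ?_
    exact hEc.mul (Complex.continuous_ofReal.comp_continuousOn hB')
  have key : ∫ t in a..b, (Complex.I * c * (E t * ((h t * B t : ℝ) : ℂ)) +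
      E t * ((B' t : ℝ) : ℂ)) = E b * (B b : ℂ) - E a * (B a : ℂ) := by
    refine intervalIntegral.integral_eq_sub_of_hasDerivAt (f := fun t => E t * (B t : ℂ)) ?_ (i1.add i2)
    intro t ht
    rw [uIcc_of_le hab] at ht
    convert! (hE t ht).mul (hB t ht).ofReal_comp using 1
    push_cast; ring
  rw [intervalIntegral.integral_add i1 i2, ha, hb, intervalIntegral.integral_const_mul] at key
  simp only [Complex.ofReal_zero, mul_zero, sub_zero] at key
  exact eq_neg_of_add_eq_zero_left key

/-- The amplitude `m^{2-γ}/n` left after one division by the derivative of the phase. -/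
noncomputable def amp (γ m n : ℝ) : ℝ := m ^ (2 - γ) / n

/-- The derivative of `amp` along `m' = n`, `n' = 2`. -/
noncomputable def ampDeriv (γ m n : ℝ) : ℝ :=
  (2 - γ) * m ^ (1 - γ) - 2 * m ^ (2 - γ) / n ^ 2

/-- The second derivative of `amp` along `m' = n`, `n' = 2`. -/
noncomputable def ampDeriv₂ (γ m n : ℝ) : ℝ :=
  (2 - γ) * (1 - γ) * m ^ (-γ) * n - 2 * (2 - γ) * m ^ (1 - γ) / n + 8 * m ^ (2 - γ) / n ^ 3

/-- The cutoff, whose square vanishes to second order at `-1/2` and `3/2`. -/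
noncomputable def cutoff (t : ℝ) : ℝ := 3 / 4 + t - t ^ 2

/-- The derivative of `cutoff² · amp`. -/
noncomputable def cutAmpDeriv (γ t m n : ℝ) : ℝ :=
  2 * cutoff t * (1 - 2 * t) * amp γ m n + cutoff t ^ 2 * ampDeriv γ m n

/-- The derivative of `(m²/n) · cutAmpDeriv`. -/
noncomputable def cutAmpDeriv₂ (γ t m n : ℝ) : ℝ :=
  (2 * m - 2 * m ^ 2 / n ^ 2) * cutAmpDeriv γ t m n + m ^ 2 / n *
    ((2 * (1 - 2 * t) ^ 2 - 4 * cutoff t) * amp γ m n +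
      4 * cutoff t * (1 - 2 * t) * ampDeriv γ m n + cutoff t ^ 2 * ampDeriv₂ γ m n)

section Derivatives

variable {γ t : ℝ} {m n : ℝ → ℝ} (hm0 : 0 < m t) (hn0 : 0 < n t)
  (hm : HasDerivAt m (n t) t) (hn : HasDerivAt n 2 t)

include hm0 hn0 hm hn

theorem hasDerivAt_amp :
    HasDerivAt (fun t => amp γ (m t) (n t)) (ampDeriv γ (m t) (n t)) t := by
  have h := (hm.rpow_const (p := 2 - γ) (Or.inl hm0.ne')).fun_div hn hn0.ne'
  refine h.congr_deriv ?_
  rw [ampDeriv, show 2 - γ - 1 = 1 - γ by ring]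
  field_simp

theorem hasDerivAt_ampDeriv :
    HasDerivAt (fun t => ampDeriv γ (m t) (n t)) (ampDeriv₂ γ (m t) (n t)) t := by
  have h1 := (hm.rpow_const (p := 1 - γ) (Or.inl hm0.ne')).const_mul (2 - γ)
  have h2 := ((hm.rpow_const (p := 2 - γ) (Or.inl hm0.ne')).const_mul 2).fun_div (hn.fun_pow 2)
    (pow_ne_zero 2 hn0.ne')
  refine (h1.fun_sub h2).congr_deriv ?_
  rw [ampDeriv₂, show 2 - γ - 1 = 1 - γ by ring, show 1 - γ - 1 = -γ by ring]
  field_simp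
  ring

omit hm0 hn0 hm hn in
theorem hasDerivAt_cutoff : HasDerivAt cutoff (1 - 2 * t) t := by
  have h := ((hasDerivAt_id t).const_add (3 / 4)).fun_sub ((hasDerivAt_id t).fun_pow 2)
  refine h.congr_deriv ?_
  simp

theorem hasDerivAt_cutoff_sq_mul_amp :
    HasDerivAt (fun t => cutoff t ^ 2 * amp γ (m t) (n t)) (cutAmpDeriv γ t (m t) (n t)) t := by
  refine ((hasDerivAt_cutoff.fun_pow 2).fun_mul (hasDerivAt_amp hm0 hn0 hm hn)).congr_deriv ?_
  rw [cutAmpDeriv]; ring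

theorem hasDerivAt_cutAmpDeriv :
    HasDerivAt (fun t => m t ^ 2 / n t * cutAmpDeriv γ t (m t) (n t))
      (cutAmpDeriv₂ γ t (m t) (n t)) t := by
  have hl : HasDerivAt (fun t : ℝ => 1 - 2 * t) (-2) t := by
    simpa using ((hasDerivAt_id t).const_mul 2).const_sub 1
  have hc := hasDerivAt_cutoff (t := t)
  have hA : HasDerivAt (fun t => cutAmpDeriv γ t (m t) (n t)) _ t :=
    (((hc.const_mul 2).fun_mul hl).fun_mul (hasDerivAt_amp hm0 hn0 hm hn)).fun_add
      ((hc.fun_pow 2).fun_mul (hasDerivAt_ampDeriv hm0 hn0 hm hn))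
  refine (((hm.fun_pow 2).fun_div hn hn0.ne').fun_mul hA).congr_deriv ?_
  simp only [cutAmpDeriv₂]
  field_simp
  ring

end Derivatives

/-- Compactness: treating `t`, `m`, `n` as independent variables in a box away from the
singularities yields a constant free of `s`, `s'` and `N`. -/
theorem exists_bound_cutAmpDeriv₂ (γ : ℝ) : ∃ C : ℝ, ∀ t ∈ Icc (-1 / 2 : ℝ) (3 / 2),
    ∀ m ∈ Icc (1 / 4 : ℝ) 13, ∀ n ∈ Icc (1 : ℝ) 7,
      |cutAmpDeriv₂ γ t m n| ≤ C ∧ |cutoff t ^ 2 * m ^ (-γ)| ≤ C := by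
  have hK : IsCompact (Icc (-1 / 2 : ℝ) (3 / 2) ×ˢ (Icc (1 / 4 : ℝ) 13 ×ˢ Icc (1 : ℝ) 7)) :=
    isCompact_Icc.prod (isCompact_Icc.prod isCompact_Icc)
  have hp : ∀ e : ℝ, ContinuousOn (fun z : ℝ × ℝ × ℝ => z.2.1 ^ e)
      (Icc (-1 / 2 : ℝ) (3 / 2) ×ˢ (Icc (1 / 4 : ℝ) 13 ×ˢ Icc (1 : ℝ) 7)) := by
    intro e
    refine ContinuousOn.rpow_const (by fun_prop) fun z hz => Or.inl ?_
    have := hz.2.1.1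
    exact (lt_of_lt_of_le (by norm_num) this).ne'
  have hn : ∀ z ∈ Icc (-1 / 2 : ℝ) (3 / 2) ×ˢ (Icc (1 / 4 : ℝ) 13 ×ˢ Icc (1 : ℝ) 7),
      z.2.2 ≠ 0 := fun z hz => (lt_of_lt_of_le one_pos hz.2.2.1).ne'
  have h1 := hp (-γ)
  have h2 := hp (1 - γ)
  have h3 := hp (2 - γ)
  obtain ⟨C, hC⟩ := hK.exists_bound_of_continuousOn
    (f := fun z : ℝ × ℝ × ℝ => cutAmpDeriv₂ γ z.1 z.2.1 z.2.2) (by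
      unfold cutAmpDeriv₂ cutAmpDeriv amp ampDeriv ampDeriv₂ cutoff
      have hn2 : ∀ z ∈ Icc (-1 / 2 : ℝ) (3 / 2) ×ˢ (Icc (1 / 4 : ℝ) 13 ×ˢ Icc (1 : ℝ) 7),
        z.2.2 ^ 2 ≠ 0 := fun z hz => pow_ne_zero _ (hn z hz)
      have hn3 : ∀ z ∈ Icc (-1 / 2 : ℝ) (3 / 2) ×ˢ (Icc (1 / 4 : ℝ) 13 ×ˢ Icc (1 : ℝ) 7),
        z.2.2 ^ 3 ≠ 0 := fun z hz => pow_ne_zero _ (hn z hz)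
      fun_prop (disch := assumption))
  obtain ⟨C', hC'⟩ := hK.exists_bound_of_continuousOn
    (f := fun z : ℝ × ℝ × ℝ => cutoff z.1 ^ 2 * z.2.1 ^ (-γ)) (by
      unfold cutoff; fun_prop)
  refine ⟨max C C', fun t ht m hm n hn => ⟨?_, ?_⟩⟩
  · exact (hC (t, m, n) ⟨ht, hm, hn⟩).trans (le_max_left _ _)
  · exact (hC' (t, m, n) ⟨ht, hm, hn⟩).trans (le_max_right _ _)

/-- With `m = (1+t+s)(1+t+s')` and `n = m'`, the phase difference has derivative `N(s-s') n/m²`. The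
scale `N(s-s')` is thus separated from a positive factor that is bounded above and below, and
`m^{-γ}` is the modulus of the product of kernels. -/
theorem exists_norm_integral_oscKernel_mul_conj_le (γ : ℝ) : ∃ C : ℝ, 0 < C ∧
    ∀ N : ℝ, ∀ s ∈ Icc (0 : ℝ) 1, ∀ s' ∈ Icc (0 : ℝ) 1,
      ‖∫ t in (-1 / 2 : ℝ)..(3 / 2), ((cutoff t ^ 2 : ℝ) : ℂ) *
        (oscKernel γ N t s * (starRingEnd ℂ) (oscKernel γ N t s'))‖ ≤
        C * (1 + (N * (s - s')) ^ 2)⁻¹ := by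
  obtain ⟨C, hC⟩ := exists_bound_cutAmpDeriv₂ γ
  have hC0 : 0 ≤ C := by
    have := (hC 0 (by norm_num) 1 (by norm_num) 1 (by norm_num)).1
    exact (abs_nonneg _).trans this
  -- Both `‖J‖` and `(N(s-s'))² ‖J‖` will be at most `2C`, as the interval has length `2`; the extra
  -- `1` makes the constant positive.
  refine ⟨4 * C + 1, by linarith, fun N s hs s' hs' => ?_⟩
  set m : ℝ → ℝ := fun t => (1 + t + s) * (1 + t + s') with hm_def
  set n : ℝ → ℝ := fun t => (1 + t + s) + (1 + t + s') with hn_def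
  set E : ℝ → ℂ := fun t => Complex.exp (Complex.I * ((N / (1 + t + s) - N / (1 + t + s') : ℝ) : ℂ))
    with hE_def
  have hx : ∀ t ∈ Icc (-1 / 2 : ℝ) (3 / 2), 1 / 2 ≤ 1 + t + s ∧ 1 + t + s ≤ 7 / 2 :=
    fun t ht => ⟨by linarith [ht.1, hs.1], by linarith [ht.2, hs.2]⟩
  have hx' : ∀ t ∈ Icc (-1 / 2 : ℝ) (3 / 2), 1 / 2 ≤ 1 + t + s' ∧ 1 + t + s' ≤ 7 / 2 :=
    fun t ht => ⟨by linarith [ht.1, hs'.1], by linarith [ht.2, hs'.2]⟩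
  have hmI : ∀ t ∈ Icc (-1 / 2 : ℝ) (3 / 2), m t ∈ Icc (1 / 4 : ℝ) 13 := by
    intro t ht
    obtain ⟨h1, h2⟩ := hx t ht
    obtain ⟨h3, h4⟩ := hx' t ht
    constructor <;> simp only [hm_def] <;> nlinarith
  have hnI : ∀ t ∈ Icc (-1 / 2 : ℝ) (3 / 2), n t ∈ Icc (1 : ℝ) 7 := by
    intro t ht
    obtain ⟨h1, h2⟩ := hx t ht
    obtain ⟨h3, h4⟩ := hx' t ht
    constructor <;> simp only [hn_def] <;> linarith
  have hm0 : ∀ t ∈ Icc (-1 / 2 : ℝ) (3 / 2), 0 < m t := fun t ht => by linarith [(hmI t ht).1]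
  have hn0 : ∀ t ∈ Icc (-1 / 2 : ℝ) (3 / 2), 0 < n t := fun t ht => by linarith [(hnI t ht).1]
  have hdx : ∀ (r t : ℝ), HasDerivAt (fun t : ℝ => 1 + t + r) 1 t := fun r t =>
    ((hasDerivAt_id t).const_add 1).add_const r
  have hdm : ∀ t, HasDerivAt m (n t) t := fun t =>
    ((hdx s t).fun_mul (hdx s' t)).congr_deriv (by simp only [hn_def]; ring)
  have hdn : ∀ t, HasDerivAt n 2 t := fun t =>
    ((hdx s t).fun_add (hdx s' t)).congr_deriv (by norm_num)
  have hmc : Continuous m := by fun_prop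
  have hnc : Continuous n := by fun_prop
  have hdE : ∀ t ∈ Icc (-1 / 2 : ℝ) (3 / 2), HasDerivAt E
      (Complex.I * (((N * (s - s')) * (n t / m t ^ 2) : ℝ) : ℂ) * E t) t := by
    intro t ht
    have hx0 : 1 + t + s ≠ 0 := by linarith [(hx t ht).1]
    have hx0' : 1 + t + s' ≠ 0 := by linarith [(hx' t ht).1]
    have h1 : HasDerivAt (fun t : ℝ => N / (1 + t + s) - N / (1 + t + s'))
        (N * (s - s') * (n t / m t ^ 2)) t := by
      refine (((hasDerivAt_const t N).fun_div (hdx s t) hx0).fun_sub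
        ((hasDerivAt_const t N).fun_div (hdx s' t) hx0')).congr_deriv ?_
      simp only [hm_def, hn_def]
      field_simp
      ring
    refine (h1.ofReal_comp.const_mul Complex.I).cexp.congr_deriv ?_
    simp only [hE_def]; ring
  have hE1 : ∀ t, ‖E t‖ = 1 := fun t => by
    simp only [hE_def, mul_comm Complex.I]
    exact Complex.norm_exp_ofReal_mul_I _
  have hle : (-1 / 2 : ℝ) ≤ 3 / 2 := by norm_num
  have hc1 : cutoff (-1 / 2) = 0 := by norm_num [cutoff]
  have hc2 : cutoff (3 / 2) = 0 := by norm_num [cutoff]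
  have hhc : ContinuousOn (fun t => n t / m t ^ 2) (Icc (-1 / 2 : ℝ) (3 / 2)) :=
    hnc.continuousOn.div (hmc.pow 2).continuousOn fun t ht => pow_ne_zero 2 (hm0 t ht).ne'
  have hp : ∀ e : ℝ, ContinuousOn (fun t : ℝ => m t ^ e) (Icc (-1 / 2 : ℝ) (3 / 2)) := fun e =>
    hmc.continuousOn.rpow_const fun t ht => Or.inl (hm0 t ht).ne'
  have h1 := hp (-γ)
  have h2 := hp (1 - γ)
  have h3 := hp (2 - γ)
  have hne1 : ∀ t ∈ Icc (-1 / 2 : ℝ) (3 / 2), n t ≠ 0 := fun t ht => (hn0 t ht).ne'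
  have hne2 : ∀ t ∈ Icc (-1 / 2 : ℝ) (3 / 2), n t ^ 2 ≠ 0 := fun t ht => pow_ne_zero _ (hne1 t ht)
  have hne3 : ∀ t ∈ Icc (-1 / 2 : ℝ) (3 / 2), n t ^ 3 ≠ 0 := fun t ht => pow_ne_zero _ (hne1 t ht)
  have hBc1 : ContinuousOn (fun t => cutAmpDeriv γ t (m t) (n t)) (Icc (-1 / 2 : ℝ) (3 / 2)) := by
    unfold cutAmpDeriv amp ampDeriv cutoff
    clear_value m n
    fun_prop (disch := assumption)
  have hBc2 : ContinuousOn (fun t => cutAmpDeriv₂ γ t (m t) (n t)) (Icc (-1 / 2 : ℝ) (3 / 2)) := by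
    unfold cutAmpDeriv₂ cutAmpDeriv amp ampDeriv ampDeriv₂ cutoff
    clear_value m n
    fun_prop (disch := assumption)
  have p1 := integral_oscillating_by_parts hle hdE
    (fun t ht => hasDerivAt_cutoff_sq_mul_amp (γ := γ) (hm0 t ht) (hn0 t ht) (hdm t) (hdn t))
    hhc hBc1 (by simp [hc1]) (by simp [hc2])
  have p2 := integral_oscillating_by_parts hle hdE
    (fun t ht => hasDerivAt_cutAmpDeriv (γ := γ) (hm0 t ht) (hn0 t ht) (hdm t) (hdn t))
    hhc hBc2 (by simp [hc1, cutAmpDeriv]) (by simp [hc2, cutAmpDeriv])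
  have c1 : ∫ t in (-1 / 2 : ℝ)..(3 / 2), ((cutoff t ^ 2 : ℝ) : ℂ) *
        (oscKernel γ N t s * (starRingEnd ℂ) (oscKernel γ N t s')) =
      ∫ t in (-1 / 2 : ℝ)..(3 / 2), E t * ((cutoff t ^ 2 * m t ^ (-γ) : ℝ) : ℂ) := by
    refine intervalIntegral.integral_congr fun t ht => ?_
    rw [uIcc_of_le hle] at ht
    have hx0 : 0 ≤ 1 + t + s := by linarith [(hx t ht).1]
    have hx0' : 0 ≤ 1 + t + s' := by linarith [(hx' t ht).1]
    simp only [oscKernel, hm_def, hE_def, map_div₀, ← Complex.exp_conj, map_mul, Complex.conj_I,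
      Complex.conj_ofReal]
    rw [Real.rpow_neg (by positivity), Real.mul_rpow hx0 hx0', Complex.ofReal_sub, mul_sub, sub_eq_add_neg,
      Complex.exp_add]
    push_cast
    rw [neg_mul]
    ring
  have c2 : ∫ t in (-1 / 2 : ℝ)..(3 / 2), E t * ((cutoff t ^ 2 * m t ^ (-γ) : ℝ) : ℂ) =
      ∫ t in (-1 / 2 : ℝ)..(3 / 2), E t *
        ((n t / m t ^ 2 * (cutoff t ^ 2 * amp γ (m t) (n t)) : ℝ) : ℂ) := by
    refine intervalIntegral.integral_congr fun t ht => ?_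
    rw [uIcc_of_le hle] at ht
    have hmt := hm0 t ht
    have hnt := hn0 t ht
    have e : m t ^ (2 - γ) = m t ^ (-γ) * m t ^ 2 := by
      rw [← Real.rpow_natCast, ← Real.rpow_add hmt]; congr 1; push_cast; ring
    simp only [amp, e]
    congr 2
    field_simp
  -- The new amplitude is again put in the form `h B`. This `B` keeps a factor of the cutoff, so it
  -- still vanishes at the ends and a second integration by parts is possible.
  have c3 : ∫ t in (-1 / 2 : ℝ)..(3 / 2), E t * ((cutAmpDeriv γ t (m t) (n t) : ℝ) : ℂ) =
      ∫ t in (-1 / 2 : ℝ)..(3 / 2), E t *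
        ((n t / m t ^ 2 * (m t ^ 2 / n t * cutAmpDeriv γ t (m t) (n t)) : ℝ) : ℂ) := by
    refine intervalIntegral.integral_congr fun t ht => ?_
    rw [uIcc_of_le hle] at ht
    have hmt := hm0 t ht
    have hnt := hn0 t ht
    congr 2
    field_simp
  set J := ∫ t in (-1 / 2 : ℝ)..(3 / 2), E t * ((cutoff t ^ 2 * m t ^ (-γ) : ℝ) : ℂ) with hJ
  have b1 : ‖J‖ ≤ 2 * C := by
    have : ‖J‖ ≤ C * |(3 / 2 : ℝ) - -1 / 2| := by
      refine intervalIntegral.norm_integral_le_of_norm_le_const fun t ht => ?_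
      rw [uIoc_of_le hle] at ht
      have ht' := Ioc_subset_Icc_self ht
      rw [norm_mul, hE1, one_mul, Complex.norm_real]
      exact (hC t ht' _ (hmI t ht') _ (hnI t ht')).2
    refine this.trans (le_of_eq ?_)
    norm_num; ring
  have b2 : ‖∫ t in (-1 / 2 : ℝ)..(3 / 2), E t * ((cutAmpDeriv₂ γ t (m t) (n t) : ℝ) : ℂ)‖ ≤ 2 * C := by
    have : ‖∫ t in (-1 / 2 : ℝ)..(3 / 2), E t * ((cutAmpDeriv₂ γ t (m t) (n t) : ℝ) : ℂ)‖ ≤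
        C * |(3 / 2 : ℝ) - -1 / 2| := by
      refine intervalIntegral.norm_integral_le_of_norm_le_const fun t ht => ?_
      rw [uIoc_of_le hle] at ht
      have ht' := Ioc_subset_Icc_self ht
      rw [norm_mul, hE1, one_mul, Complex.norm_real]
      exact (hC t ht' _ (hmI t ht') _ (hnI t ht')).1
    refine this.trans (le_of_eq ?_)
    norm_num; ring
  have b3 : (N * (s - s')) ^ 2 * ‖J‖ ≤ 2 * C := by
    rw [← c2] at p1
    rw [← c3] at p2
    refine le_trans (le_of_eq ?_) b2
    have e := congrArg norm p2
    have e' := congrArg norm p1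
    simp only [norm_mul, norm_neg, Complex.norm_I, one_mul, Complex.norm_real] at e e'
    rw [← e, ← e', mul_pow, ← sq_abs N, ← sq_abs (s - s'), ← Real.norm_eq_abs, ← Real.norm_eq_abs]
    ring
  rw [c1, ← div_eq_mul_inv, le_div_iff₀ (by positivity)]
  linarith

/-! ### The `L²` estimate -/

theorem integral_inv_one_add_sq_le {N : ℝ} (hN : 0 < N) (s : ℝ) :
    ∫ s', (1 + (N * (s - s')) ^ 2)⁻¹ ∂unitMeasure ≤ Real.pi / N := by
  have hi : Integrable fun s' : ℝ => (1 + (N * (s - s')) ^ 2)⁻¹ :=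
    (integrable_inv_one_add_sq.comp_mul_left' hN.ne').comp_sub_left s
  have h1 : ∫ s', (1 + (N * (s - s')) ^ 2)⁻¹ = Real.pi / N := by
    rw [integral_sub_left_eq_self (fun x => (1 + (N * x) ^ 2)⁻¹) volume s,
      Measure.integral_comp_mul_left (fun x : ℝ => (1 + x ^ 2)⁻¹) N, integral_univ_inv_one_add_sq,
      abs_of_pos (inv_pos.2 hN), smul_eq_mul]
    field_simp
  rw [← h1]
  exact setIntegral_le_integral hi (Filter.Eventually.of_forall fun x => by positivity)

/-- Schur test: `2φ(s)φ(s') ≤ φ(s)² + φ(s')²`, and by symmetry of the kernel both squares contribute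
equally, each costing the integral of the kernel in one variable. -/
theorem integral_prod_mul_inv_one_add_sq_le {N : ℝ} (hN : 0 < N) {φ : ℝ → ℝ}
    (hφ : Measurable φ) (hφ0 : ∀ s, 0 ≤ φ s) {C : ℝ} (hC : ∀ s, φ s ≤ C) :
    ∫ z, φ z.1 * φ z.2 * (1 + (N * (z.1 - z.2)) ^ 2)⁻¹ ∂unitMeasure.prod unitMeasure ≤
      Real.pi / N * ∫ s, φ s ^ 2 ∂unitMeasure := by
  have hk1 : ∀ z : ℝ × ℝ, (1 + (N * (z.1 - z.2)) ^ 2)⁻¹ ≤ 1 := fun z =>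
    inv_le_one_of_one_le₀ (by nlinarith [sq_nonneg (N * (z.1 - z.2))])
  have hk0 : ∀ z : ℝ × ℝ, 0 ≤ (1 + (N * (z.1 - z.2)) ^ 2)⁻¹ := fun z => by positivity
  have hi : ∀ g : ℝ × ℝ → ℝ, Measurable g → (∀ z, 0 ≤ g z) → (∀ z, g z ≤ C ^ 2) →
      Integrable (fun z => g z * (1 + (N * (z.1 - z.2)) ^ 2)⁻¹)
        (unitMeasure.prod unitMeasure) := by
    intro g hg hg0 hgC
    refine Integrable.of_bound (C := C ^ 2) (by fun_prop) (Filter.Eventually.of_forall fun z => ?_)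
    rw [Real.norm_of_nonneg (mul_nonneg (hg0 z) (hk0 z))]
    exact (mul_le_of_le_one_right (hg0 z) (hk1 z)).trans (hgC z)
  have hsq : ∀ s, φ s ^ 2 ≤ C ^ 2 := fun s => pow_le_pow_left₀ (hφ0 s) (hC s) 2
  have i1 := hi (fun z => φ z.1 ^ 2) (by fun_prop) (fun z => by positivity) fun z => hsq _
  have i2 := hi (fun z => φ z.2 ^ 2) (by fun_prop) (fun z => by positivity) fun z => hsq _
  have i0 := hi (fun z => φ z.1 * φ z.2) (by fun_prop) (fun z => mul_nonneg (hφ0 _) (hφ0 _))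
    fun z => by nlinarith [hsq z.1, hsq z.2, sq_nonneg (φ z.1 - φ z.2)]
  have hswap : ∫ z, φ z.2 ^ 2 * (1 + (N * (z.1 - z.2)) ^ 2)⁻¹ ∂unitMeasure.prod unitMeasure =
      ∫ z, φ z.1 ^ 2 * (1 + (N * (z.1 - z.2)) ^ 2)⁻¹ ∂unitMeasure.prod unitMeasure := by
    rw [← integral_prod_swap]
    congr 1; ext z
    simp only [Prod.fst_swap, Prod.snd_swap]
    congr 2; ring
  calc ∫ z, φ z.1 * φ z.2 * (1 + (N * (z.1 - z.2)) ^ 2)⁻¹ ∂unitMeasure.prod unitMeasure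
      ≤ ∫ z, (1 / 2) * (φ z.1 ^ 2 * (1 + (N * (z.1 - z.2)) ^ 2)⁻¹ +
          φ z.2 ^ 2 * (1 + (N * (z.1 - z.2)) ^ 2)⁻¹) ∂unitMeasure.prod unitMeasure := by
        refine integral_mono i0 ((i1.add i2).const_mul _) fun z => ?_
        have := mul_nonneg (sq_nonneg (φ z.1 - φ z.2)) (hk0 z)
        simp only
        nlinarith
    _ = ∫ z, φ z.1 ^ 2 * (1 + (N * (z.1 - z.2)) ^ 2)⁻¹ ∂unitMeasure.prod unitMeasure := by
        rw [integral_const_mul, integral_add i1 i2, hswap]; ring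
    _ = ∫ s, φ s ^ 2 * ∫ s', (1 + (N * (s - s')) ^ 2)⁻¹ ∂unitMeasure ∂unitMeasure := by
        rw [integral_prod _ i1]
        congr 1; ext s
        exact integral_const_mul (φ s ^ 2) _
    _ ≤ ∫ s, φ s ^ 2 * (Real.pi / N) ∂unitMeasure := by
        have hi2 : Integrable (fun s => φ s ^ 2) unitMeasure :=
          Integrable.of_bound (C := C ^ 2) (by fun_prop) (Filter.Eventually.of_forall fun s => by
            rw [Real.norm_of_nonneg (sq_nonneg _)]; exact hsq s)
        refine integral_mono_of_nonneg (Filter.Eventually.of_forall fun s => ?_)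
          (hi2.mul_const _) (Filter.Eventually.of_forall fun s => ?_)
        · exact mul_nonneg (sq_nonneg _) (integral_nonneg fun s' => by positivity)
        · exact mul_le_mul_of_nonneg_left (integral_inv_one_add_sq_le hN s) (sq_nonneg _)
    _ = Real.pi / N * ∫ s, φ s ^ 2 ∂unitMeasure := by
        rw [integral_mul_const, mul_comm]

/-- Expand `|T_N f|²` as a double integral and apply Fubini; simple functions are bounded, which
makes the triple integrand integrable. -/
theorem integral_cutoff_sq_mul_norm_oscOp_sq {γ N : ℝ} (hγ : 0 ≤ γ) (f : SimpleFunc ℝ ℂ) :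
    ((∫ t in (-1 / 2 : ℝ)..(3 / 2), cutoff t ^ 2 * ‖oscOp γ N f t‖ ^ 2 : ℝ) : ℂ) =
      ∫ z, f z.1 * (starRingEnd ℂ) (f z.2) * (∫ t in (-1 / 2 : ℝ)..(3 / 2),
        ((cutoff t ^ 2 : ℝ) : ℂ) * (oscKernel γ N t z.1 * (starRingEnd ℂ) (oscKernel γ N t z.2)))
        ∂unitMeasure.prod unitMeasure := by
  have hle : (-1 / 2 : ℝ) ≤ 3 / 2 := by norm_num
  have hKm : Measurable fun z : ℝ × ℝ => oscKernel γ N z.1 z.2 := measurable_oscKernel γ N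
  have hK1 : Measurable fun w : ℝ × ℝ × ℝ => oscKernel γ N w.1 w.2.1 :=
    hKm.comp (f := fun w : ℝ × ℝ × ℝ => (w.1, w.2.1)) (by fun_prop)
  have hK2 : Measurable fun w : ℝ × ℝ × ℝ => oscKernel γ N w.1 w.2.2 :=
    hKm.comp (f := fun w : ℝ × ℝ × ℝ => (w.1, w.2.2)) (by fun_prop)
  have hcm : Measurable cutoff := by unfold cutoff; fun_prop
  obtain ⟨M, hM⟩ := f.exists_forall_norm_le
  have hM0 : 0 ≤ M := (norm_nonneg _).trans (hM 0)
  set ν : Measure ℝ := volume.restrict (Ioc (-1 / 2 : ℝ) (3 / 2)) with hν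
  -- On the enlarged interval `1 + t + s` may drop to `1/2`, so the bound `1` for the kernel is no
  -- longer available.
  have hKb : ∀ t ∈ Ioc (-1 / 2 : ℝ) (3 / 2), ∀ s ∈ Icc (0 : ℝ) 1,
      ‖oscKernel γ N t s‖ ≤ ((1 / 2 : ℝ) ^ γ)⁻¹ := by
    intro t ht s hs
    rw [norm_oscKernel (by linarith [ht.1, hs.1])]
    have : (1 / 2 : ℝ) ^ γ ≤ (1 + t + s) ^ γ :=
      Real.rpow_le_rpow (by norm_num) (by linarith [ht.1, hs.1]) hγ
    exact inv_anti₀ (by positivity) this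
  have hint : Integrable (fun w : ℝ × ℝ × ℝ => ((cutoff w.1 ^ 2 : ℝ) : ℂ) *
      ((oscKernel γ N w.1 w.2.1 * f w.2.1) *
        (starRingEnd ℂ) (oscKernel γ N w.1 w.2.2 * f w.2.2)))
      (ν.prod (unitMeasure.prod unitMeasure)) := by
    have hfm := f.measurable
    refine Integrable.of_bound (C := 1 * ((((1 / 2 : ℝ) ^ γ)⁻¹ * M) * (((1 / 2 : ℝ) ^ γ)⁻¹ * M))) ?_ ?_
    · have e1 : Measurable fun w : ℝ × ℝ × ℝ => oscKernel γ N w.1 w.2.1 * f w.2.1 :=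
        hK1.mul (by fun_prop)
      have e2 : Measurable fun w : ℝ × ℝ × ℝ =>
          (starRingEnd ℂ) (oscKernel γ N w.1 w.2.2 * f w.2.2) :=
        Complex.continuous_conj.measurable.comp
          (g := starRingEnd ℂ) (f := fun w : ℝ × ℝ × ℝ => oscKernel γ N w.1 w.2.2 * f w.2.2)
          (hK2.mul (by fun_prop))
      have e3 : Measurable fun w : ℝ × ℝ × ℝ => ((cutoff w.1 ^ 2 : ℝ) : ℂ) := by fun_prop
      exact (e3.mul (e1.mul e2)).aestronglyMeasurable
    · have : ∀ᵐ w ∂ν.prod (unitMeasure.prod unitMeasure),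
          w ∈ Ioc (-1 / 2 : ℝ) (3 / 2) ×ˢ (Icc (0 : ℝ) 1 ×ˢ Icc (0 : ℝ) 1) := by
        rw [hν, unitMeasure, Measure.prod_restrict, Measure.prod_restrict]
        exact ae_restrict_mem (measurableSet_Ioc.prod (measurableSet_Icc.prod measurableSet_Icc))
      filter_upwards [this] with w hw
      rw [norm_mul, norm_mul, RCLike.norm_conj, norm_mul, norm_mul, Complex.norm_real,
        Real.norm_of_nonneg (sq_nonneg _)]
      have h0 : 0 ≤ cutoff w.1 := by unfold cutoff; nlinarith [hw.1.1, hw.1.2]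
      have h1 : cutoff w.1 ≤ 1 := by unfold cutoff; nlinarith [sq_nonneg (w.1 - 1 / 2)]
      have h2 := hKb _ hw.1 _ hw.2.1
      have h3 := hKb _ hw.1 _ hw.2.2
      gcongr
      · exact pow_le_one₀ h0 h1
      · exact hM _
      · exact hM _
  have step : ∀ t, ((cutoff t ^ 2 * ‖oscOp γ N f t‖ ^ 2 : ℝ) : ℂ) =
      ∫ z, ((cutoff t ^ 2 : ℝ) : ℂ) * ((oscKernel γ N t z.1 * f z.1) *
        (starRingEnd ℂ) (oscKernel γ N t z.2 * f z.2)) ∂unitMeasure.prod unitMeasure := by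
    intro t
    rw [integral_const_mul, integral_prod_mul (fun s => oscKernel γ N t s * f s)
      (fun s => (starRingEnd ℂ) (oscKernel γ N t s * f s)), integral_conj, Complex.ofReal_mul]
    congr 1
    rw [← Complex.normSq_eq_norm_sq, ← Complex.mul_conj]
    rfl
  rw [← intervalIntegral.integral_ofReal]
  simp_rw [step]
  rw [intervalIntegral.integral_of_le hle, integral_integral_swap hint]
  congr 1; ext z
  rw [intervalIntegral.integral_of_le hle, ← integral_const_mul]
  congr 1; ext t
  rw [map_mul]; ring

theorem exists_integral_norm_oscOp_sq_le {γ : ℝ} (hγ : 0 ≤ γ) : ∃ A : ℝ, 1 ≤ A ∧ ∀ N : ℝ, 0 ≤ N →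
    ∀ f : SimpleFunc ℝ ℂ, ∫ t, ‖oscOp γ N f t‖ ^ 2 ∂unitMeasure ≤
      A * (1 + N)⁻¹ * ∫ s, ‖f s‖ ^ 2 ∂unitMeasure := by
  obtain ⟨C, hC, hL⟩ := exists_norm_integral_oscKernel_mul_conj_le γ
  -- The factor `16/9` comes from `cutoff ≥ 3/4` on `[0,1]`, the `2π` from `π/N ≤ 2π/(1+N)` for `N ≥
  -- 1`, and the summand `2` covers `N ≤ 1`, where the trivial bound suffices.
  refine ⟨16 / 9 * (2 * C * Real.pi) + 2, by linarith [mul_pos hC Real.pi_pos], fun N hN f => ?_⟩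
  have hle : (-1 / 2 : ℝ) ≤ 3 / 2 := by norm_num
  have hI : 0 ≤ ∫ s, ‖f s‖ ^ 2 ∂unitMeasure := integral_nonneg fun s => by positivity
  obtain ⟨M, hM⟩ := f.exists_forall_norm_le
  have hfi : Integrable f unitMeasure := SimpleFunc.integrable_of_isFiniteMeasure f
  have hf2 : Integrable (fun s => ‖f s‖ ^ 2) unitMeasure :=
    Integrable.of_bound (C := M ^ 2) (by have := f.measurable; fun_prop)
      (Filter.Eventually.of_forall fun s => by
        rw [Real.norm_of_nonneg (sq_nonneg _)]
        exact pow_le_pow_left₀ (norm_nonneg _) (hM s) 2)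
  have hTm := (stronglyMeasurable_oscOp (γ := γ) (N := N) hfi.1).measurable
  rcases le_total N 1 with h1 | h1
  · have hsq : (∫ s, ‖f s‖ ∂unitMeasure) ^ 2 ≤ ∫ s, ‖f s‖ ^ 2 ∂unitMeasure := by
      exact ConvexOn.map_integral_le (convexOn_pow 2) (by fun_prop) isClosed_Ici
        (Filter.Eventually.of_forall fun s => norm_nonneg _) hfi.norm hf2
    have h2 : ∫ t, ‖oscOp γ N f t‖ ^ 2 ∂unitMeasure ≤
        ∫ _t, (∫ s, ‖f s‖ ^ 2 ∂unitMeasure) ∂unitMeasure := by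
      refine integral_mono_of_nonneg (Filter.Eventually.of_forall fun t => by positivity)
        (integrable_const _) ?_
      filter_upwards [ae_norm_oscOp_le hγ hfi] with t ht
      exact (pow_le_pow_left₀ (norm_nonneg _) ht 2).trans hsq
    rw [integral_const, probReal_univ, one_smul] at h2
    refine h2.trans (le_mul_of_one_le_left hI ?_)
    rw [← div_eq_mul_inv, le_div_iff₀ (by linarith)]
    nlinarith [mul_pos hC Real.pi_pos]
  · have hN0 : 0 < N := by linarith
    have hcut : Continuous cutoff := by unfold cutoff; fun_prop
    have hTb : ∀ t ∈ Icc (-1 / 2 : ℝ) (3 / 2), ‖oscOp γ N f t‖ ≤ ((1 / 2 : ℝ) ^ γ)⁻¹ * M := by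
      intro t ht
      have := norm_integral_le_of_norm_le_const (μ := unitMeasure)
        (f := fun s => oscKernel γ N t s * f s) (C := ((1 / 2 : ℝ) ^ γ)⁻¹ * M) (by
          filter_upwards [ae_unitMeasure_mem] with s hs
          rw [norm_mul, norm_oscKernel (by linarith [ht.1, hs.1])]
          have : (1 / 2 : ℝ) ^ γ ≤ (1 + t + s) ^ γ :=
            Real.rpow_le_rpow (by norm_num) (by linarith [ht.1, hs.1]) hγ
          gcongr
          exact hM s)
      rwa [probReal_univ, mul_one] at this
    have hii : IntegrableOn (fun t => cutoff t ^ 2 * ‖oscOp γ N f t‖ ^ 2)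
        (Icc (-1 / 2 : ℝ) (3 / 2)) := by
      refine Integrable.of_bound (C := 1 * (((1 / 2 : ℝ) ^ γ)⁻¹ * M) ^ 2)
        (by fun_prop) ?_
      filter_upwards [ae_restrict_mem measurableSet_Icc] with t ht
      rw [Real.norm_of_nonneg (by positivity)]
      have h0 : 0 ≤ cutoff t := by unfold cutoff; nlinarith [ht.1, ht.2]
      have h1 : cutoff t ≤ 1 := by unfold cutoff; nlinarith [sq_nonneg (t - 1 / 2)]
      have h2 := hTb t ht
      gcongr
      exact pow_le_one₀ h0 h1
    have key : ∫ t in (-1 / 2 : ℝ)..(3 / 2), cutoff t ^ 2 * ‖oscOp γ N f t‖ ^ 2 ≤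
        C * (Real.pi / N * ∫ s, ‖f s‖ ^ 2 ∂unitMeasure) := by
      have e := congrArg norm (integral_cutoff_sq_mul_norm_oscOp_sq (N := N) hγ f)
      rw [Complex.norm_real] at e
      refine (le_abs_self _).trans ?_
      rw [← Real.norm_eq_abs, e]
      refine le_trans ?_ (mul_le_mul_of_nonneg_left (integral_prod_mul_inv_one_add_sq_le hN0
        (φ := fun s => ‖f s‖) f.measurable.norm (fun s => norm_nonneg _) hM) hC.le)
      rw [← integral_const_mul]
      refine norm_integral_le_of_norm_le ?_ ?_
      · refine Integrable.of_bound (C := C * (M * M * 1))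
          (by have := f.measurable; fun_prop) (Filter.Eventually.of_forall fun z => ?_)
        rw [Real.norm_of_nonneg (by positivity)]
        have h1 : (1 + (N * (z.1 - z.2)) ^ 2)⁻¹ ≤ 1 :=
          inv_le_one_of_one_le₀ (by nlinarith [sq_nonneg (N * (z.1 - z.2))])
        have h2 := hM z.1
        have h3 := hM z.2
        have h4 : 0 ≤ M := (norm_nonneg _).trans h2
        gcongr
      · filter_upwards [ae_unitMeasure_prod_mem] with z hz
        rw [norm_mul, norm_mul, RCLike.norm_conj]
        refine (mul_le_mul_of_nonneg_left (hL N z.1 hz.1 z.2 hz.2) (by positivity)).trans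
          (le_of_eq ?_)
        ring
    have low : 9 / 16 * ∫ t, ‖oscOp γ N f t‖ ^ 2 ∂unitMeasure ≤
        ∫ t in (-1 / 2 : ℝ)..(3 / 2), cutoff t ^ 2 * ‖oscOp γ N f t‖ ^ 2 := by
      rw [intervalIntegral.integral_of_le hle, ← integral_Icc_eq_integral_Ioc]
      have hsub : Icc (0 : ℝ) 1 ⊆ Icc (-1 / 2 : ℝ) (3 / 2) := Icc_subset_Icc (by norm_num) (by norm_num)
      refine le_trans ?_ (setIntegral_mono_set hii
        (Filter.Eventually.of_forall fun t => by positivity) hsub.eventuallyLE)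
      rw [← integral_const_mul]
      refine integral_mono_of_nonneg (Filter.Eventually.of_forall fun t => by positivity)
        (hii.mono_set hsub) ?_
      filter_upwards [ae_unitMeasure_mem] with t ht
      have h3 : 3 / 4 ≤ cutoff t := by unfold cutoff; nlinarith [ht.1, ht.2]
      have : (9 / 16 : ℝ) ≤ cutoff t ^ 2 := by nlinarith
      gcongr
    have hfin : Real.pi / N ≤ 2 * Real.pi * (1 + N)⁻¹ := by
      rw [← div_eq_mul_inv, div_le_div_iff₀ hN0 (by linarith)]
      nlinarith [Real.pi_pos]
    have h5 : C * (Real.pi / N * ∫ s, ‖f s‖ ^ 2 ∂unitMeasure) ≤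
        C * (2 * Real.pi * (1 + N)⁻¹ * ∫ s, ‖f s‖ ^ 2 ∂unitMeasure) := by gcongr
    have h6 : 0 ≤ (1 + N)⁻¹ * ∫ s, ‖f s‖ ^ 2 ∂unitMeasure := by positivity
    nlinarith

/-! ### Lower bounds from explicit test functions -/

theorem le_bestConst (γ N : ℝ) {p q : ℝ≥0∞} {f : ℝ → ℂ} (hf : MemLp f p unitMeasure)
    (hf0 : ¬ f =ᵐ[unitMeasure] 0) :
    eLpNorm (oscOp γ N f) q unitMeasure / eLpNorm f p unitMeasure ≤ bestConst γ N p q :=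
  le_iSup_of_le f (le_iSup_of_le hf (le_iSup_of_le hf0 le_rfl))

theorem ofReal_mul_measure_rpow_le_eLpNorm {α : Type*} [MeasurableSpace α] {μ : Measure α}
    {S : Set α} (hS : MeasurableSet S) (hμ : μ S ≠ 0) {c : ℝ} (hc : 0 ≤ c) {h : α → ℂ}
    (hh : ∀ t ∈ S, c ≤ ‖h t‖) {q : ℝ≥0∞} (hq : q ≠ 0) :
    ENNReal.ofReal c * μ S ^ (1 / q.toReal) ≤ eLpNorm h q μ := by
  have e := eLpNorm_indicator_const' (c := c) hS hμ hq
  rw [Real.enorm_of_nonneg hc] at e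
  rw [← e]
  refine eLpNorm_mono fun t => ?_
  by_cases ht : t ∈ S
  · rw [indicator_of_mem ht, Real.norm_of_nonneg hc]; exact hh t ht
  · rw [indicator_of_notMem ht, norm_zero]; exact norm_nonneg _

theorem recip_eq (p : ℝ≥0∞) : recip p = 1 / p.toReal := by
  rw [recip, ENNReal.toReal_inv, one_div]

theorem unitMeasure_Icc_zero {d : ℝ} (hd : d ≤ 1) :
    unitMeasure (Icc 0 d) = ENNReal.ofReal d := by
  rw [unitMeasure, Measure.restrict_apply measurableSet_Icc,
    inter_eq_left.2 (Icc_subset_Icc_right hd), Real.volume_Icc, sub_zero]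

/-- The lower bound `3^{-γ}/2` for the real part of the kernel when its phase varies by at most
one. -/
noncomputable def kernelLower (γ : ℝ) : ℝ := ((3 : ℝ) ^ γ)⁻¹ / 2

theorem kernelLower_pos (γ : ℝ) : 0 < kernelLower γ := by unfold kernelLower; positivity

section

variable {γ N t : ℝ} (hγ : 0 ≤ γ) (hN : 0 ≤ N) (ht : t ∈ Icc (0 : ℝ) 1)

include hγ in
theorem kernelLower_le_re {x : ℝ} (hx1 : 1 ≤ x) (hx3 : x ≤ 3) {θ : ℝ} (hθ : |θ| ≤ 1) :
    kernelLower γ ≤ Real.cos θ / x ^ γ := by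
  have h1 : 1 / 2 ≤ Real.cos θ := by
    have := Real.one_sub_sq_div_two_le_cos (x := θ)
    have h2 : θ ^ 2 ≤ 1 := by rw [← sq_abs]; exact pow_le_one₀ (abs_nonneg _) hθ
    linarith
  have h3 : ((3 : ℝ) ^ γ)⁻¹ ≤ (x ^ γ)⁻¹ :=
    inv_anti₀ (by positivity) (Real.rpow_le_rpow (by linarith) hx3 hγ)
  rw [kernelLower, div_eq_mul_inv, div_eq_mul_inv, mul_comm (Real.cos θ)]
  have : 0 ≤ (x ^ γ)⁻¹ := by positivity
  exact mul_le_mul h3 (by linarith) (by norm_num) this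

theorem re_exp_mul_oscKernel (γ N t s α : ℝ) :
    (Complex.exp (-(Complex.I * (α : ℂ))) * oscKernel γ N t s).re =
      Real.cos (N / (1 + t + s) - α) / (1 + t + s) ^ γ := by
  rw [oscKernel, ← mul_div_assoc, ← Complex.exp_add, Complex.div_ofReal_re]
  congr 1
  rw [← Complex.exp_ofReal_mul_I_re]
  congr 2
  push_cast; ring

include hN in
theorem abs_phase_sub_le {x y : ℝ} (hx : 1 ≤ x) (hxy : x ≤ y) (h : N * (y - x) ≤ 1) :
    |N / y - N / x| ≤ 1 := by
  have hx0 : 0 < x := by linarith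
  have hy0 : 0 < y := by linarith
  have e : N / y - N / x = -(N * (y - x) / (x * y)) := by field_simp; ring
  have h0 : 0 ≤ N * (y - x) := mul_nonneg hN (by linarith)
  rw [e, abs_neg, abs_of_nonneg (by positivity), div_le_one (by positivity)]
  nlinarith

theorem intervalIntegrable_oscKernel (γ N : ℝ) (ht : 0 ≤ t) {a b : ℝ} (ha : 0 ≤ a) (hab : a ≤ b) :
    IntervalIntegrable (fun s => oscKernel γ N t s) volume a b := by
  have hne : ∀ s ∈ Icc a b, 1 + t + s ≠ 0 := fun s hs => by
    have := hs.1; exact (by linarith : 0 < 1 + t + s).ne'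
  have hne' : ∀ s ∈ Icc a b, (((1 + t + s) ^ γ : ℝ) : ℂ) ≠ 0 := fun s hs => by
    have := hs.1
    exact Complex.ofReal_ne_zero.2 (Real.rpow_pos_of_pos (by linarith) γ).ne'
  have hp : ContinuousOn (fun s : ℝ => (1 + t + s) ^ γ) (Icc a b) :=
    ContinuousOn.rpow_const (by fun_prop) fun s hs => Or.inl (hne s hs)
  refine ContinuousOn.intervalIntegrable_of_Icc hab ?_
  unfold oscKernel
  refine ContinuousOn.div ?_ (Complex.continuous_ofReal.comp_continuousOn hp) hne'
  refine Complex.continuous_exp.comp_continuousOn (continuousOn_const.mul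
    (Complex.continuous_ofReal.comp_continuousOn ?_))
  exact continuousOn_const.div (by fun_prop) hne

include hγ hN ht in
-- On an interval of length at most `1/N` the phase moves by at most `1`. Rotating by its value at
-- the left end leaves an integrand with real part at least `kernelLower γ`, so nothing cancels.
theorem mul_kernelLower_le_norm_integral {a b : ℝ} (ha : 0 ≤ a) (hab : a ≤ b) (hb : b ≤ 1)
    (h : N * (b - a) ≤ 1) :
    (b - a) * kernelLower γ ≤ ‖∫ s in a..b, oscKernel γ N t s‖ := by
  set α := N / (1 + t + a)
  have hi := (intervalIntegrable_oscKernel γ N ht.1 ha hab).const_mul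
    (Complex.exp (-(Complex.I * (α : ℂ))))
  have e1 : ‖∫ s in a..b, oscKernel γ N t s‖ =
      ‖∫ s in a..b, Complex.exp (-(Complex.I * (α : ℂ))) * oscKernel γ N t s‖ := by
    rw [intervalIntegral.integral_const_mul, norm_mul]
    have : ‖Complex.exp (-(Complex.I * (α : ℂ)))‖ = 1 := by
      rw [show -(Complex.I * (α : ℂ)) = ((-α : ℝ) : ℂ) * Complex.I by push_cast; ring]
      exact Complex.norm_exp_ofReal_mul_I _
    rw [this, one_mul]
  rw [e1]
  refine le_trans ?_ (Complex.re_le_norm _)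
  have e2 : (∫ s in a..b, Complex.exp (-(Complex.I * (α : ℂ))) * oscKernel γ N t s).re =
      ∫ s in a..b, (Complex.exp (-(Complex.I * (α : ℂ))) * oscKernel γ N t s).re :=
    (Complex.reCLM.intervalIntegral_comp_comm hi).symm
  rw [e2, ← smul_eq_mul, ← intervalIntegral.integral_const]
  refine intervalIntegral.integral_mono_on hab (by simp)
    ⟨Complex.reCLM.integrable_comp hi.1, Complex.reCLM.integrable_comp hi.2⟩ fun s hs => ?_
  rw [re_exp_mul_oscKernel]
  refine kernelLower_le_re hγ (by linarith [ht.1, hs.1]) (by linarith [ht.2, hs.2]) ?_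
  refine abs_phase_sub_le hN (by linarith [ht.1]) (by linarith [hs.1]) (le_trans ?_ h)
  exact mul_le_mul_of_nonneg_left (by linarith [hs.2]) hN

end

theorem oscOp_eq_intervalIntegral (γ N : ℝ) (f : ℝ → ℂ) (t : ℝ) :
    oscOp γ N f t = ∫ s in (0 : ℝ)..1, oscKernel γ N t s * f s := by
  rw [intervalIntegral.integral_of_le zero_le_one, ← integral_Icc_eq_integral_Ioc]
  rfl

/-- Test on the indicator of `[0, d]` with `d = 1/(1+N)`: its norm is `d^{1/p}`, while `|T_N f|` is
at least `d` times a constant on all of `[0,1]`. -/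
theorem le_bestConst_concentrated_input {γ N : ℝ} (hγ : 0 ≤ γ) (hN : 0 ≤ N) {p q : ℝ≥0∞}
    (hp : 1 ≤ p) (hq : 1 ≤ q) :
    ENNReal.ofReal (kernelLower γ * (1 + N) ^ (-1 + recip p)) ≤ bestConst γ N p q := by
  set d : ℝ := (1 + N)⁻¹ with hd
  have hd0 : 0 < d := by positivity
  have hd1 : d ≤ 1 := inv_le_one_of_one_le₀ (by linarith)
  have hNd : N * (d - 0) ≤ 1 := by
    rw [sub_zero, hd, ← div_eq_mul_inv, div_le_one (by linarith)]; linarith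
  have hμ : unitMeasure (Icc 0 d) ≠ 0 := by
    rw [unitMeasure_Icc_zero hd1]; simpa using hd0
  have hp0 : p ≠ 0 := (one_pos.trans_le hp).ne'
  have hq0 : q ≠ 0 := (one_pos.trans_le hq).ne'
  set f : ℝ → ℂ := (Icc 0 d).indicator fun _ => (1 : ℂ) with hf
  have hfn : eLpNorm f p unitMeasure = ENNReal.ofReal (d ^ recip p) := by
    rw [hf, eLpNorm_indicator_const' measurableSet_Icc hμ hp0, unitMeasure_Icc_zero hd1, recip_eq,
      ENNReal.ofReal_rpow_of_pos hd0]
    simp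
  have hfm : MemLp f p unitMeasure :=
    memLp_indicator_const p measurableSet_Icc 1 (Or.inr (measure_ne_top _ _))
  have hf0 : ¬ f =ᵐ[unitMeasure] 0 := by
    rw [← eLpNorm_eq_zero_iff hfm.1 hp0, hfn]
    simp only [ENNReal.ofReal_eq_zero, not_le]; positivity
  refine le_trans ?_ (le_bestConst γ N hfm hf0)
  have hT : ∀ t ∈ Icc (0 : ℝ) 1, d * kernelLower γ ≤ ‖oscOp γ N f t‖ := by
    intro t ht
    have e : oscOp γ N f t = ∫ s in (0 : ℝ)..d, oscKernel γ N t s := by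
      rw [intervalIntegral.integral_of_le hd0.le, ← integral_Icc_eq_integral_Ioc, oscOp, unitMeasure]
      have : (fun s => oscKernel γ N t s * f s) =
          (Icc 0 d).indicator fun s => oscKernel γ N t s := by
        ext s; by_cases hs : s ∈ Icc 0 d <;> simp [hf, hs]
      rw [this, integral_indicator measurableSet_Icc, Measure.restrict_restrict measurableSet_Icc,
        inter_eq_left.2 (Icc_subset_Icc_right hd1)]
    rw [e]
    simpa using mul_kernelLower_le_norm_integral hγ hN ht le_rfl hd0.le hd1 hNd
  have key := ofReal_mul_measure_rpow_le_eLpNorm (μ := unitMeasure) measurableSet_Icc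
    (by rw [unitMeasure_Icc_zero le_rfl]; simp) (mul_nonneg hd0.le (kernelLower_pos γ).le) hT hq0
  rw [unitMeasure_Icc_zero le_rfl, ENNReal.ofReal_one, ENNReal.one_rpow, mul_one] at key
  refine le_trans (le_of_eq ?_) (ENNReal.div_le_div_right key _)
  rw [hfn, ← ENNReal.ofReal_div_of_pos (by positivity)]
  congr 1
  rw [Real.rpow_add (by linarith), Real.rpow_neg_one, ← hd, hd, Real.inv_rpow (by linarith)]
  field_simp

/-- Test on the unimodular function conjugate to the phase at `t = 0`: for `t ≤ d = 1/(1+N)` the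
remaining phase is at most `1`, so `|T_N f|` is bounded below on a set of measure `d`. -/
theorem le_bestConst_concentrated_output {γ N : ℝ} (hγ : 0 ≤ γ) (hN : 0 ≤ N) {p q : ℝ≥0∞}
    (hp : 1 ≤ p) (hq : 1 ≤ q) :
    ENNReal.ofReal (kernelLower γ * (1 + N) ^ (-recip q)) ≤ bestConst γ N p q := by
  set d : ℝ := (1 + N)⁻¹ with hd
  have hd0 : 0 < d := by positivity
  have hd1 : d ≤ 1 := inv_le_one_of_one_le₀ (by linarith)
  have hNd : N * d ≤ 1 := by
    rw [hd, ← div_eq_mul_inv, div_le_one (by linarith)]; linarith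
  have hp0 : p ≠ 0 := (one_pos.trans_le hp).ne'
  have hq0 : q ≠ 0 := (one_pos.trans_le hq).ne'
  set f : ℝ → ℂ := fun s => Complex.exp (-(Complex.I * ((N / (1 + s) : ℝ) : ℂ))) with hf
  have hf1 : ∀ s, ‖f s‖ = 1 := fun s => by
    simp only [hf]
    rw [show -(Complex.I * ((N / (1 + s) : ℝ) : ℂ)) = ((-(N / (1 + s)) : ℝ) : ℂ) * Complex.I by
      push_cast; ring]
    exact Complex.norm_exp_ofReal_mul_I _
  have hfmeas : Measurable f := by fun_prop
  have hfm : ∀ r, MemLp f r unitMeasure := fun r =>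
    MemLp.of_bound hfmeas.aestronglyMeasurable 1 (Filter.Eventually.of_forall fun s => (hf1 s).le)
  have hfn : eLpNorm f p unitMeasure = 1 := by
    rw [eLpNorm_congr_norm_ae (g := fun _ => (1 : ℝ)) (Filter.Eventually.of_forall fun s => by simp [hf1]),
      eLpNorm_const _ hp0 (IsProbabilityMeasure.ne_zero _)]
    simp
  have hf0 : ¬ f =ᵐ[unitMeasure] 0 := by
    rw [← eLpNorm_eq_zero_iff (hfm p).1 hp0, hfn]; exact one_ne_zero
  refine le_trans ?_ (le_bestConst γ N (hfm p) hf0)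
  have hT : ∀ t ∈ Icc (0 : ℝ) d, kernelLower γ ≤ ‖oscOp γ N f t‖ := by
    intro t ht
    refine le_trans ?_ (Complex.re_le_norm _)
    have hi := integrable_oscKernel_mul (N := N) hγ ((hfm 1).integrable le_rfl) ht.1
    have e2 : (oscOp γ N f t).re = ∫ s, (oscKernel γ N t s * f s).re ∂unitMeasure :=
      (Complex.reCLM.integral_comp_comm hi).symm
    have e3 : kernelLower γ = ∫ _s, kernelLower γ ∂unitMeasure := by
      rw [integral_const, probReal_univ, one_smul]
    rw [e2, e3]
    refine integral_mono_ae (integrable_const _) (Complex.reCLM.integrable_comp hi) ?_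
    filter_upwards [ae_unitMeasure_mem] with s hs
    rw [mul_comm, re_exp_mul_oscKernel]
    refine kernelLower_le_re hγ (by linarith [ht.1, hs.1]) (by linarith [ht.2, hs.2]) ?_
    refine abs_phase_sub_le hN (by linarith [hs.1]) (by linarith [ht.1]) (le_trans ?_ hNd)
    exact mul_le_mul_of_nonneg_left (by linarith [ht.2]) hN
  have key := ofReal_mul_measure_rpow_le_eLpNorm (μ := unitMeasure) measurableSet_Icc
    (by rw [unitMeasure_Icc_zero hd1]; simpa using hd0) (kernelLower_pos γ).le hT hq0
  rw [hfn, div_one]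
  refine le_trans (le_of_eq ?_) key
  rw [unitMeasure_Icc_zero hd1, ENNReal.ofReal_rpow_of_pos hd0,
    ← ENNReal.ofReal_mul (kernelLower_pos γ).le, ← recip_eq, hd, Real.inv_rpow (by linarith),
    Real.rpow_neg (by linarith)]

/-! ### Moments of random signed sums -/

section RandomSigns

variable {ι : Type*} [DecidableEq ι]

/-- The sum of the `c j` over `s`, with sign `+` on `A` and `-` off `A`. -/
noncomputable def signedSum (c : ι → ℂ) (s A : Finset ι) : ℂ :=
  ∑ j ∈ s, (if j ∈ A then 1 else -1) * c j

theorem signedSum_insert_of_notMem {c : ι → ℂ} {s A : Finset ι} {a : ι} (ha : a ∉ s) (hA : A ⊆ s) :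
    signedSum c (insert a s) A = signedSum c s A - c a := by
  rw [signedSum, Finset.sum_insert ha, if_neg fun h => ha (hA h), signedSum]; ring

theorem signedSum_insert_insert {c : ι → ℂ} {s A : Finset ι} {a : ι} (ha : a ∉ s) :
    signedSum c (insert a s) (insert a A) = signedSum c s A + c a := by
  rw [signedSum, Finset.sum_insert ha, if_pos (Finset.mem_insert_self a A), signedSum, one_mul,
    add_comm]
  congr 1
  refine Finset.sum_congr rfl fun j hj => ?_
  have : j ≠ a := fun h => ha (h ▸ hj)
  simp [Finset.mem_insert, this]

/-- Orthogonality of signs: the parallelogram law pairs the two signs of each new term. -/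
theorem sum_norm_signedSum_sq (c : ι → ℂ) (s : Finset ι) :
    ∑ A ∈ s.powerset, ‖signedSum c s A‖ ^ 2 = 2 ^ s.card * ∑ j ∈ s, ‖c j‖ ^ 2 := by
  induction s using Finset.induction_on with
  | empty => simp [signedSum]
  | insert a s ha ih =>
    rw [Finset.sum_powerset_insert ha, ← Finset.sum_add_distrib]
    have : ∀ A ∈ s.powerset, ‖signedSum c (insert a s) A‖ ^ 2 +
        ‖signedSum c (insert a s) (insert a A)‖ ^ 2 =
        2 * ‖signedSum c s A‖ ^ 2 + 2 * ‖c a‖ ^ 2 := by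
      intro A hA
      rw [signedSum_insert_of_notMem ha (Finset.mem_powerset.1 hA), signedSum_insert_insert ha]
      have := parallelogram_law_with_norm ℝ (signedSum c s A) (c a)
      nlinarith
    rw [Finset.sum_congr rfl this, Finset.sum_add_distrib, ← Finset.mul_sum, ih,
      Finset.sum_insert ha, Finset.card_insert_of_notMem ha, Finset.sum_const,
      Finset.card_powerset, nsmul_eq_mul]
    push_cast; ring

theorem norm_sub_pow_four_add_norm_add_pow_four_le (x y : ℂ) :
    ‖x - y‖ ^ 4 + ‖x + y‖ ^ 4 ≤ 2 * ‖x‖ ^ 4 + 12 * (‖x‖ ^ 2 * ‖y‖ ^ 2) + 2 * ‖y‖ ^ 4 := by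
  have h1 := norm_sub_sq_real x y
  have h2 := norm_add_sq_real x y
  have h3 := abs_real_inner_le_norm x y
  have h4 : (inner ℝ x y) ^ 2 ≤ ‖x‖ ^ 2 * ‖y‖ ^ 2 := by
    rw [← sq_abs, ← mul_pow]; exact pow_le_pow_left₀ (abs_nonneg _) h3 2
  have e1 : ‖x - y‖ ^ 4 = (‖x - y‖ ^ 2) ^ 2 := by ring
  have e2 : ‖x + y‖ ^ 4 = (‖x + y‖ ^ 2) ^ 2 := by ring
  rw [e1, e2, h1, h2]
  nlinarith

/-- Induction with the two-point estimate. The cross term `12 ‖c a‖² V`, with `V` the sum of squares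
over `s`, is exactly the one in `6 (V + ‖c a‖²)²`, which is why the constant `3` propagates. -/
theorem sum_norm_signedSum_pow_four_le (c : ι → ℂ) (s : Finset ι) :
    ∑ A ∈ s.powerset, ‖signedSum c s A‖ ^ 4 ≤ 3 * 2 ^ s.card * (∑ j ∈ s, ‖c j‖ ^ 2) ^ 2 := by
  induction s using Finset.induction_on with
  | empty => simp [signedSum]
  | insert a s ha ih =>
    rw [Finset.sum_powerset_insert ha, ← Finset.sum_add_distrib]
    have : ∀ A ∈ s.powerset, ‖signedSum c (insert a s) A‖ ^ 4 +
        ‖signedSum c (insert a s) (insert a A)‖ ^ 4 ≤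
        2 * ‖signedSum c s A‖ ^ 4 + 12 * ‖c a‖ ^ 2 * ‖signedSum c s A‖ ^ 2 + 2 * ‖c a‖ ^ 4 := by
      intro A hA
      rw [signedSum_insert_of_notMem ha (Finset.mem_powerset.1 hA), signedSum_insert_insert ha]
      refine (norm_sub_pow_four_add_norm_add_pow_four_le _ _).trans (le_of_eq (by ring))
    refine (Finset.sum_le_sum this).trans ?_
    rw [Finset.sum_add_distrib, Finset.sum_add_distrib, ← Finset.mul_sum, ← Finset.mul_sum,
      sum_norm_signedSum_sq, Finset.sum_insert ha, Finset.card_insert_of_notMem ha,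
      Finset.sum_const, Finset.card_powerset, nsmul_eq_mul]
    push_cast
    have h4 : 0 ≤ (2 : ℝ) ^ s.card * ‖c a‖ ^ 4 := by positivity
    rw [pow_succ (2 : ℝ) s.card]
    nlinarith

/-- Khinchine's lower bound in `L¹`: a large second moment and a controlled fourth moment force a
large first moment, through the pointwise inequality `u ≥ u²/r - u⁴/r³` for `u ≥ 0`. -/
theorem le_sum_norm_signedSum (c : ι → ℂ) (s : Finset ι) {δ k : ℝ} (hδ : 0 < δ)
    (hlow : k * δ ≤ ∑ j ∈ s, ‖c j‖ ^ 2) (hup : ∑ j ∈ s, ‖c j‖ ^ 2 ≤ δ) :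
    2 ^ s.card * (k / 5 * √δ) ≤ ∑ A ∈ s.powerset, ‖signedSum c s A‖ := by
  set V := ∑ j ∈ s, ‖c j‖ ^ 2 with hV
  have hV0 : 0 ≤ V := Finset.sum_nonneg fun j _ => by positivity
  -- With `r² = 6δ` and `V ≤ δ`, the fourth-moment term absorbs at most half of the second-moment
  -- term.
  set r := √(6 * δ) with hr
  have hr0 : 0 < r := Real.sqrt_pos.2 (by linarith)
  have hr2 : r ^ 2 = 6 * δ := Real.sq_sqrt (by linarith)
  have hpt : ∀ u : ℝ, 0 ≤ u → u ^ 2 / r - u ^ 4 / r ^ 3 ≤ u := by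
    intro u hu
    have e : u - (u ^ 2 / r - u ^ 4 / r ^ 3) = u * (r ^ 3 - u * r ^ 2 + u ^ 3) / r ^ 3 := by
      field_simp; ring
    have : 0 ≤ r ^ 3 - u * r ^ 2 + u ^ 3 := by
      rcases le_total u r with h | h
      · nlinarith [mul_nonneg (sq_nonneg r) (sub_nonneg.2 h), pow_nonneg hu 3]
      · have : r ^ 2 ≤ u ^ 2 := pow_le_pow_left₀ hr0.le h 2
        nlinarith [pow_pos hr0 3]
    have h2 : 0 ≤ u * (r ^ 3 - u * r ^ 2 + u ^ 3) / r ^ 3 := by positivity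
    linarith
  have h1 : ∑ A ∈ s.powerset, (‖signedSum c s A‖ ^ 2 / r - ‖signedSum c s A‖ ^ 4 / r ^ 3) ≤
      ∑ A ∈ s.powerset, ‖signedSum c s A‖ :=
    Finset.sum_le_sum fun A _ => hpt _ (norm_nonneg _)
  rw [Finset.sum_sub_distrib, ← Finset.sum_div, ← Finset.sum_div, sum_norm_signedSum_sq, ← hV] at h1
  refine le_trans ?_ h1
  have h4 := sum_norm_signedSum_pow_four_le c s
  rw [← hV] at h4
  have h5 : (∑ A ∈ s.powerset, ‖signedSum c s A‖ ^ 4) / r ^ 3 ≤ 3 * 2 ^ s.card * V ^ 2 / r ^ 3 := by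
    gcongr
  refine le_trans ?_ (sub_le_sub_left h5 _)
  have h6 : 2 ^ s.card * V / r - 3 * 2 ^ s.card * V ^ 2 / r ^ 3 =
      2 ^ s.card * (V / r * (1 - 3 * V / r ^ 2)) := by field_simp
  rw [h6]
  refine mul_le_mul_of_nonneg_left ?_ (by positivity)
  have h7 : 1 / 2 ≤ 1 - 3 * V / r ^ 2 := by
    have : 3 * V / r ^ 2 ≤ 1 / 2 := by
      rw [hr2, div_le_iff₀ (by positivity)]; linarith
    linarith
  refine le_trans ?_ (mul_le_mul_of_nonneg_left h7 (by positivity))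
  have hs : √δ ^ 2 = δ := Real.sq_sqrt hδ.le
  have hs0 : 0 < √δ := Real.sqrt_pos.2 hδ
  -- Since `2√6 < 5`; this is the `5` in the statement.
  have hr5 : 2 * r ≤ 5 * √δ := by
    refine (pow_le_pow_iff_left₀ (by positivity) (by positivity) two_ne_zero).1 ?_
    rw [mul_pow, mul_pow, hr2, hs]; linarith
  rw [div_mul_div_comm, mul_one, mul_comm r 2]
  rw [le_div_iff₀ (by positivity)]
  rcases le_total k 0 with hk | hk
  · have : k / 5 * √δ * (2 * r) ≤ 0 := by
      have : k / 5 ≤ 0 := by linarith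
      exact mul_nonpos_of_nonpos_of_nonneg (mul_nonpos_of_nonpos_of_nonneg this hs0.le) (by positivity)
    linarith
  · calc k / 5 * √δ * (2 * r) ≤ k / 5 * √δ * (5 * √δ) := by gcongr
      _ = k * √δ ^ 2 := by ring
      _ ≤ V := by rw [hs]; exact hlow

end RandomSigns

/-! ### The lower bound from random signs -/

/-- The function equal to `1` on the intervals `[j/M, (j+1)/M)` with `j ∈ A`, and to `-1`
elsewhere. -/
noncomputable def signFun (M : ℕ) (A : Finset ℕ) (s : ℝ) : ℂ :=
  if ⌊(M : ℝ) * s⌋₊ ∈ A then 1 else -1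

theorem measurable_signFun (M : ℕ) (A : Finset ℕ) : Measurable (signFun M A) := by
  unfold signFun
  refine Measurable.ite ?_ measurable_const measurable_const
  have : Measurable fun s : ℝ => ⌊(M : ℝ) * s⌋₊ := by fun_prop
  exact this (MeasurableSet.of_discrete (s := (A : Set ℕ)))

theorem norm_signFun (M : ℕ) (A : Finset ℕ) (s : ℝ) : ‖signFun M A s‖ = 1 := by
  unfold signFun; split_ifs <;> simp

theorem memLp_signFun (M : ℕ) (A : Finset ℕ) (p : ℝ≥0∞) : MemLp (signFun M A) p unitMeasure :=
  MemLp.of_bound (measurable_signFun M A).aestronglyMeasurable 1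
    (Filter.Eventually.of_forall fun s => (norm_signFun M A s).le)

theorem eLpNorm_signFun (M : ℕ) (A : Finset ℕ) {p : ℝ≥0∞} (hp : p ≠ 0) :
    eLpNorm (signFun M A) p unitMeasure = 1 := by
  rw [eLpNorm_congr_norm_ae (g := fun _ => (1 : ℝ))
    (Filter.Eventually.of_forall fun s => by simp [norm_signFun]),
    eLpNorm_const _ hp (IsProbabilityMeasure.ne_zero _)]
  simp

theorem oscOp_signFun {γ N t : ℝ} (hγ : 0 ≤ γ) (ht : 0 ≤ t) {M : ℕ} (hM : 0 < M) (A : Finset ℕ) :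
    oscOp γ N (signFun M A) t = signedSum
      (fun j : ℕ => ∫ s in ((j : ℝ) / M)..((j + 1 : ℝ) / M), oscKernel γ N t s) (Finset.range M) A := by
  have hM' : (0 : ℝ) < M := by exact_mod_cast hM
  have hi : IntervalIntegrable (fun s => oscKernel γ N t s * signFun M A s) volume 0 1 := by
    rw [intervalIntegrable_iff_integrableOn_Icc_of_le zero_le_one]
    exact integrable_oscKernel_mul hγ ((memLp_signFun M A 1).integrable le_rfl) ht
  have hsum := intervalIntegral.sum_integral_adjacent_intervals (μ := volume)
    (f := fun s => oscKernel γ N t s * signFun M A s) (a := fun j : ℕ => (j : ℝ) / M) (n := M)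
    (fun k hk => by
      refine hi.mono_set ?_
      have hk' : ((k + 1 : ℕ) : ℝ) ≤ M := by exact_mod_cast hk
      rw [uIcc_of_le zero_le_one, uIcc_of_le (by gcongr; simp)]
      exact Icc_subset_Icc (by positivity) ((div_le_one hM').2 hk'))
  rw [oscOp_eq_intervalIntegral, signedSum]
  simp only [Nat.cast_zero, zero_div, div_self hM'.ne'] at hsum
  rw [← hsum]
  refine Finset.sum_congr rfl fun j _ => ?_
  rw [← intervalIntegral.integral_const_mul]
  push_cast
  refine intervalIntegral.integral_congr_Ioo_of_le (by gcongr; simp) fun s hs => ?_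
  have h1 : (j : ℝ) ≤ M * s := by
    have := hs.1.le; rw [div_le_iff₀ hM'] at this; linarith
  have h2 : (M : ℝ) * s < j + 1 := by
    have := hs.2; rw [lt_div_iff₀ hM'] at this; linarith
  have h3 : ⌊(M : ℝ) * s⌋₊ = j := (Nat.floor_eq_iff (by linarith [(Nat.cast_nonneg j : (0 : ℝ) ≤ j)])).2 ⟨h1, h2⟩
  simp only [signFun, h3]
  ring

/-- Each of the `M` intervals contributes a number of modulus comparable to `1/M`. With random signs
these add up to about `M · M^{-2}` in mean square, hence to about `M^{-1/2}` on average in modulus,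
for every `t` at once. Integrating in `t` and averaging selects one good choice of signs. -/
theorem le_bestConst_signs {γ N : ℝ} (hγ : 0 ≤ γ) (hN : 0 ≤ N) {p q : ℝ≥0∞}
    (hp : 1 ≤ p) (hq : 1 ≤ q) :
    ENNReal.ofReal (kernelLower γ ^ 2 / 5 * (1 + N) ^ (-(1 / 2 : ℝ))) ≤ bestConst γ N p q := by
  have hp0 : p ≠ 0 := (one_pos.trans_le hp).ne'
  -- This gives `N ≤ M ≤ 1 + N`: the first keeps the phase variation on each interval at most `1`,
  -- the second turns `M^{-1/2}` into `(1+N)^{-1/2}`. It also keeps `M` positive at `N = 0`.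
  set M : ℕ := ⌊N⌋₊ + 1 with hMdef
  have hM : 0 < M := Nat.succ_pos _
  have hM' : (0 : ℝ) < M := by exact_mod_cast hM
  have hNM : N ≤ M := by rw [hMdef]; push_cast; exact (Nat.lt_floor_add_one N).le
  have hMN : (M : ℝ) ≤ 1 + N := by
    rw [hMdef]; push_cast; linarith [Nat.floor_le hN]
  set δ : ℝ := (M : ℝ)⁻¹ with hδ
  have hδ0 : 0 < δ := by positivity
  set κ := kernelLower γ with hκ
  have hκ0 : 0 < κ := kernelLower_pos γ
  set c : ℝ → ℕ → ℂ := fun t j => ∫ s in ((j : ℝ) / M)..((j + 1 : ℝ) / M), oscKernel γ N t s with hc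
  have hlen : ∀ j : ℕ, (j + 1 : ℝ) / M - (j : ℝ) / M = δ := fun j => by rw [hδ]; field_simp; ring
  have hj1 : ∀ j ∈ Finset.range M, (j + 1 : ℝ) / M ≤ 1 := fun j hj => by
    rw [div_le_one hM']; exact_mod_cast Finset.mem_range.1 hj
  have hjle : ∀ j : ℕ, (j : ℝ) / M ≤ (j + 1 : ℝ) / M := fun j => by gcongr; simp
  have hclow : ∀ t ∈ Icc (0 : ℝ) 1, ∀ j ∈ Finset.range M, δ * κ ≤ ‖c t j‖ := by
    intro t ht j hj
    rw [← hlen j]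
    refine mul_kernelLower_le_norm_integral hγ hN ht (by positivity) (hjle j) (hj1 j hj) ?_
    rw [hlen, hδ, ← div_eq_mul_inv, div_le_one hM']; exact hNM
  have hcup : ∀ t ∈ Icc (0 : ℝ) 1, ∀ j ∈ Finset.range M, ‖c t j‖ ≤ δ := by
    intro t ht j hj
    have := intervalIntegral.norm_integral_le_of_norm_le_const (a := (j : ℝ) / M)
      (b := (j + 1 : ℝ) / M) (f := fun s => oscKernel γ N t s) (C := 1) fun s hs => by
        rw [uIoc_of_le (hjle j)] at hs
        exact norm_oscKernel_le_one hγ ht.1 (le_trans (by positivity) hs.1.le)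
    rwa [hlen, abs_of_pos hδ0, one_mul] at this
  have hMδ : (M : ℝ) * δ = 1 := mul_inv_cancel₀ hM'.ne'
  have havg : ∀ t ∈ Icc (0 : ℝ) 1, 2 ^ M * (κ ^ 2 / 5 * √δ) ≤
      ∑ A ∈ (Finset.range M).powerset, ‖oscOp γ N (signFun M A) t‖ := by
    intro t ht
    simp_rw [oscOp_signFun hγ ht.1 hM]
    have h := le_sum_norm_signedSum (c t) (Finset.range M) (k := κ ^ 2) hδ0 ?_ ?_
    · rwa [Finset.card_range] at h
    · have h1 : ∑ _j ∈ Finset.range M, (δ * κ) ^ 2 ≤ ∑ j ∈ Finset.range M, ‖c t j‖ ^ 2 :=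
        Finset.sum_le_sum fun j hj => pow_le_pow_left₀ (by positivity) (hclow t ht j hj) 2
      refine le_trans (le_of_eq ?_) h1
      rw [Finset.sum_const, Finset.card_range, nsmul_eq_mul]
      calc κ ^ 2 * δ = (M * δ) * (κ ^ 2 * δ) := by rw [hMδ, one_mul]
        _ = M * (δ * κ) ^ 2 := by ring
    · have h1 : ∑ j ∈ Finset.range M, ‖c t j‖ ^ 2 ≤ ∑ _j ∈ Finset.range M, δ ^ 2 :=
        Finset.sum_le_sum fun j hj => pow_le_pow_left₀ (norm_nonneg _) (hcup t ht j hj) 2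
      refine h1.trans (le_of_eq ?_)
      rw [Finset.sum_const, Finset.card_range, nsmul_eq_mul, pow_two, ← mul_assoc, hMδ, one_mul]
  have hTi : ∀ A, Integrable (fun t => ‖oscOp γ N (signFun M A) t‖) unitMeasure := fun A =>
    ((memLp_oscOp hγ ((memLp_signFun M A 1).integrable le_rfl) 1).integrable le_rfl).norm
  have hint : 2 ^ M * (κ ^ 2 / 5 * √δ) ≤
      ∑ A ∈ (Finset.range M).powerset, ∫ t, ‖oscOp γ N (signFun M A) t‖ ∂unitMeasure := by
    rw [← integral_finsetSum _ fun A _ => hTi A]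
    have e : 2 ^ M * (κ ^ 2 / 5 * √δ) = ∫ _t, 2 ^ M * (κ ^ 2 / 5 * √δ) ∂unitMeasure := by
      rw [integral_const, probReal_univ, one_smul]
    rw [e]
    refine integral_mono_ae (integrable_const _) (integrable_finsetSum _ fun A _ => hTi A) ?_
    filter_upwards [ae_unitMeasure_mem] with t ht
    exact havg t ht
  obtain ⟨A, _, hA⟩ : ∃ A ∈ (Finset.range M).powerset,
      κ ^ 2 / 5 * √δ ≤ ∫ t, ‖oscOp γ N (signFun M A) t‖ ∂unitMeasure := by
    refine Finset.exists_le_of_sum_le ⟨∅, Finset.empty_mem_powerset _⟩ (le_trans (le_of_eq ?_) hint)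
    rw [Finset.sum_const, Finset.card_powerset, Finset.card_range, nsmul_eq_mul]
    push_cast; ring
  have hf0 : ¬ signFun M A =ᵐ[unitMeasure] 0 := by
    rw [← eLpNorm_eq_zero_iff (memLp_signFun M A p).1 hp0, eLpNorm_signFun M A hp0]
    exact one_ne_zero
  refine le_trans ?_ (le_bestConst γ N (memLp_signFun M A p) hf0)
  rw [eLpNorm_signFun M A hp0, div_one]
  have hTm := memLp_oscOp (N := N) hγ ((memLp_signFun M A 1).integrable le_rfl) 1
  -- The `L¹` norm is the smallest, so its lower bound serves every `q`.
  refine le_trans ?_ (eLpNorm_le_eLpNorm_of_exponent_le hq hTm.1)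
  have e1 : eLpNorm (oscOp γ N (signFun M A)) 1 unitMeasure =
      ENNReal.ofReal (∫ t, ‖oscOp γ N (signFun M A) t‖ ∂unitMeasure) := by
    rw [integral_norm_eq_lintegral_enorm hTm.1, ← eLpNorm_one_eq_lintegral_enorm,
      ENNReal.ofReal_toReal hTm.2.ne]
  rw [e1]
  refine ENNReal.ofReal_le_ofReal (le_trans ?_ hA)
  refine mul_le_mul_of_nonneg_left ?_ (by positivity)
  rw [Real.sqrt_eq_rpow, hδ, Real.inv_rpow hM'.le, ← Real.rpow_neg hM'.le]
  exact Real.rpow_le_rpow_of_nonpos hM' hMN (by norm_num)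

/-! ### Upper bounds for all exponents and conclusion -/

theorem exists_norm_kernelForm_oscKernel_le {γ : ℝ} (hγ : 0 ≤ γ) : ∃ A : ℝ, 1 ≤ A ∧
    ∀ N : ℝ, 0 ≤ N → ∀ f g : SimpleFunc ℝ ℂ,
      ‖kernelForm unitMeasure (oscKernel γ N) f g‖ ≤ (A * (1 + N)⁻¹) ^ (1 / 2 : ℝ) *
        ((∫ x, ‖f x‖ ^ 2 ∂unitMeasure) ^ (1 / 2 : ℝ) *
          (∫ x, ‖g x‖ ^ 2 ∂unitMeasure) ^ (1 / 2 : ℝ)) := by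
  obtain ⟨A, hA, h⟩ := exists_integral_norm_oscOp_sq_le hγ
  refine ⟨A, hA, fun N hN f g => ?_⟩
  have hfi : Integrable f unitMeasure := SimpleFunc.integrable_of_isFiniteMeasure f
  have hgi : Integrable g unitMeasure := SimpleFunc.integrable_of_isFiniteMeasure g
  have hT := fun q => memLp_oscOp (N := N) hγ hfi q
  have hg := fun q => SimpleFunc.memLp_of_isFiniteMeasure g q unitMeasure
  have e : kernelForm unitMeasure (oscKernel γ N) f g =
      ∫ t, oscOp γ N f t * g t ∂unitMeasure := by
    rw [kernelForm, integral_prod _ (integrable_kernelForm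
      (measurable_oscKernel γ N).aestronglyMeasurable (ae_norm_oscKernel_le_one hγ) hfi hgi)]
    congr 1; ext t
    rw [oscOp, ← integral_mul_const]
    congr 1; ext s; ring
  have hcs := integral_mul_le_Lp_mul_Lq_of_nonneg (μ := unitMeasure)
    (f := fun t => ‖oscOp γ N f t‖) (g := fun t => ‖g t‖) Real.HolderConjugate.two_two
    (Filter.Eventually.of_forall fun t => norm_nonneg _)
    (Filter.Eventually.of_forall fun t => norm_nonneg _)
    (hT _).norm (hg _).norm
  simp only [Real.rpow_two] at hcs
  have h1 : ‖kernelForm unitMeasure (oscKernel γ N) f g‖ ≤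
      ∫ t, ‖oscOp γ N f t‖ * ‖g t‖ ∂unitMeasure := by
    rw [e]
    simp only [← norm_mul]
    exact norm_integral_le_integral_norm _
  refine h1.trans (hcs.trans ?_)
  have hI : 0 ≤ ∫ x, ‖f x‖ ^ 2 ∂unitMeasure := integral_nonneg fun x => by positivity
  rw [← mul_assoc, ← Real.mul_rpow (by positivity) hI]
  refine mul_le_mul_of_nonneg_right (Real.rpow_le_rpow ?_ (h N hN f) (by norm_num)) ?_
  · exact integral_nonneg fun x => by positivity
  · exact Real.rpow_nonneg (integral_nonneg fun x => by positivity) _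

theorem recip_le_one {p : ℝ≥0∞} (hp : 1 ≤ p) : recip p ≤ 1 := by
  have : p⁻¹ ≤ 1 := ENNReal.inv_le_one.2 hp
  simpa [recip] using ENNReal.toReal_mono ENNReal.one_ne_top this

theorem recip_nonneg (p : ℝ≥0∞) : 0 ≤ recip p := ENNReal.toReal_nonneg

theorem le_of_recip_le_recip {p q : ℝ≥0∞} (hp : 1 ≤ p) (hq : 1 ≤ q) (h : recip q ≤ recip p) :
    p ≤ q := by
  have hi : ∀ {r : ℝ≥0∞}, 1 ≤ r → r⁻¹ ≠ ∞ := fun hr =>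
    ENNReal.inv_ne_top.2 (one_pos.trans_le hr).ne'
  exact ENNReal.inv_le_inv.1 ((ENNReal.toReal_le_toReal (hi hq) (hi hp)).1 h)

theorem exists_eLpNorm_oscOp_le {γ : ℝ} (hγ : 0 ≤ γ) : ∃ A : ℝ, 1 ≤ A ∧
    ∀ N : ℝ, 0 ≤ N → ∀ p q : ℝ≥0∞, 1 ≤ p → 1 ≤ q → 1 / 2 ≤ recip p → 1 - recip p ≤ recip q →
      ∀ f : ℝ → ℂ, MemLp f p unitMeasure → eLpNorm (oscOp γ N f) q unitMeasure ≤
        ENNReal.ofReal (A * (1 + N) ^ (-1 + recip p)) * eLpNorm f p unitMeasure := by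
  obtain ⟨A, hA, h⟩ := exists_norm_kernelForm_oscKernel_le hγ
  refine ⟨A, hA, fun N hN p q hp hq hp2 hpq f hf => ?_⟩
  have hfi := hf.integrable hp
  have hTm := (stronglyMeasurable_oscOp (γ := γ) (N := N) hf.1).aestronglyMeasurable (μ := unitMeasure)
  have hptop : p ≠ ∞ := by
    rintro rfl
    rw [recip, ENNReal.inv_top, ENNReal.toReal_zero] at hp2
    norm_num at hp2
  set r := p.toReal with hr
  have hpr : p = ENNReal.ofReal r := (ENNReal.ofReal_toReal hptop).symm
  have hrec : recip p = 1 / r := recip_eq p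
  have hr1 : 1 ≤ r := by
    rw [hr]; simpa using ENNReal.toReal_mono hptop hp
  have hr2 : r ≤ 2 := by
    rw [hrec] at hp2
    exact (one_div_le_one_div two_pos (by linarith)).1 hp2
  -- At `p = 1` the dual exponent is infinite and the supremum bound is used directly; otherwise
  -- interpolate to the dual exponent and descend to `q`.
  rcases hr1.eq_or_lt with h1 | h1
  · have hp1 : p = 1 := by rw [hpr, ← h1, ENNReal.ofReal_one]
    have hb := eLpNorm_le_of_ae_bound (p := q) (ae_norm_oscOp_le (N := N) hγ hfi)
    rw [measure_univ, ENNReal.one_rpow, one_mul] at hb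
    have e : ENNReal.ofReal (∫ s, ‖f s‖ ∂unitMeasure) = eLpNorm f p unitMeasure := by
      rw [hp1, integral_norm_eq_lintegral_enorm hf.1, ← eLpNorm_one_eq_lintegral_enorm,
        ENNReal.ofReal_toReal]
      exact (memLp_one_iff_integrable.2 hfi).2.ne
    rw [e] at hb
    refine hb.trans (le_mul_of_one_le_left' ?_)
    rw [hrec, ← h1]
    simpa using hA
  · have hconj : r.HolderConjugate r.conjExponent := Real.HolderConjugate.conjExponent h1
    have hinv : r.conjExponent⁻¹ = 1 - 1 / r := by
      have := hconj.inv_add_inv_eq_one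
      rw [one_div]; linarith
    have hc1 : 1 < r.conjExponent := hconj.symm.lt
    have hqle : q ≤ ENNReal.ofReal r.conjExponent := by
      refine le_of_recip_le_recip hq (by simpa using hc1.le) ?_
      rw [recip_eq (ENNReal.ofReal _), ENNReal.toReal_ofReal (by linarith), one_div, hinv, ← hrec]
      exact hpq
    refine (eLpNorm_le_eLpNorm_of_exponent_le hqle hTm).trans ?_
    have hN1 : 0 < 1 + N := by linarith
    have key := eLpNorm_conj_le (measurable_oscKernel γ N).aestronglyMeasurable
      (ae_norm_oscKernel_le_one hγ) (A := (A * (1 + N)⁻¹) ^ (1 / 2 : ℝ)) (by positivity) (h N hN) hconj hr2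
      (hpr ▸ hf) hTm (ae_norm_oscOp_le hγ hfi)
    rw [← hpr] at key
    refine key.trans (mul_le_mul_left (ENNReal.ofReal_le_ofReal ?_) _)
    rw [← Real.rpow_mul (by positivity), Real.mul_rpow (by linarith) (by positivity),
      Real.inv_rpow hN1.le, ← Real.rpow_neg hN1.le, hrec]
    have e1 : -(1 / 2 * (2 - 2 / r)) = -1 + 1 / r := by ring
    rw [e1]
    refine mul_le_mul_of_nonneg_right ?_ (by positivity)
    have h3 : 0 < 1 / r := by positivity
    -- Interpolation yields `A^{1-1/p}`; `A ≥ 1` replaces it by a constant independent of `p`.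
    calc A ^ (1 / 2 * (2 - 2 / r)) ≤ A ^ (1 : ℝ) :=
          Real.rpow_le_rpow_of_exponent_le hA (by
            rw [show 1 / 2 * (2 - 2 / r) = 1 - 1 / r by ring]; linarith)
      _ = A := Real.rpow_one A

/-- The auxiliary exponent `p' ≤ p` (not the dual of `p`) is where the estimate is applied; the
inclusion of `L^p` in `L^{p'}` has norm at most `1`. -/
theorem exists_bestConst_le {γ : ℝ} (hγ : 0 ≤ γ) : ∃ A : ℝ, 1 ≤ A ∧
    ∀ N : ℝ, 0 ≤ N → ∀ p p' q : ℝ≥0∞, 1 ≤ p' → 1 ≤ q → p' ≤ p → 1 / 2 ≤ recip p' →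
      1 - recip p' ≤ recip q →
        bestConst γ N p q ≤ ENNReal.ofReal (A * (1 + N) ^ (-1 + recip p')) := by
  obtain ⟨A, hA, h⟩ := exists_eLpNorm_oscOp_le hγ
  refine ⟨A, hA, fun N hN p p' q hp' hq hle h2 hpq => ?_⟩
  refine iSup_le fun f => iSup_le fun hf => iSup_le fun _ => ENNReal.div_le_of_le_mul ?_
  refine (h N hN p' q hp' hq h2 hpq f (hf.mono_exponent hle)).trans ?_
  gcongr
  exact eLpNorm_le_eLpNorm_of_exponent_le hle hf.1

theorem theorem2 (γ : ℝ) (hγ : 0 ≤ γ) :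
    -- `T_N` is a well-defined operator from `L^p` to `L^q`
    (∀ N : ℝ, 0 ≤ N → ∀ p q : ℝ≥0∞, 1 ≤ p → 1 ≤ q →
      ∀ f : ℝ → ℂ, MemLp f p unitMeasure →
        (∀ t ∈ Icc (0 : ℝ) 1, Integrable (fun s => oscKernel γ N t s * f s) unitMeasure) ∧
        MemLp (oscOp γ N f) q unitMeasure) ∧
    -- the two-sided bounds, with constants that do not depend on `N`, `p`, `q`
    (∃ cA cB cC : ℝ, 0 < cA ∧ 0 < cB ∧ 0 < cC ∧
      ∀ N : ℝ, 0 ≤ N → ∀ p q : ℝ≥0∞, 1 ≤ p → 1 ≤ q →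
        (expPoint p q ∈ regionA →
          ENNReal.ofReal (cA⁻¹ * (1 + N) ^ (-1 + recip p)) ≤ bestConst γ N p q ∧
          bestConst γ N p q ≤ ENNReal.ofReal (cA * (1 + N) ^ (-1 + recip p))) ∧
        (expPoint p q ∈ regionB →
          ENNReal.ofReal (cB⁻¹ * (1 + N) ^ (-recip q)) ≤ bestConst γ N p q ∧
          bestConst γ N p q ≤ ENNReal.ofReal (cB * (1 + N) ^ (-recip q))) ∧
        (expPoint p q ∈ regionC →
          ENNReal.ofReal (cC⁻¹ * (1 + N) ^ (-(1 / 2 : ℝ))) ≤ bestConst γ N p q ∧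
          bestConst γ N p q ≤ ENNReal.ofReal (cC * (1 + N) ^ (-(1 / 2 : ℝ))))) ∧
    -- the resulting upper bound on the whole square
    (∃ c : ℝ, 0 < c ∧ ∀ N : ℝ, 0 ≤ N → ∀ p q : ℝ≥0∞, 1 ≤ p → 1 ≤ q →
      bestConst γ N p q ≤
        ENNReal.ofReal (c * (1 + N) ^ (-(min (1 - recip p) (min (recip q) (1 / 2)))))) := by

  refine ⟨fun N hN p q hp hq f hf => ⟨fun t ht => integrable_oscKernel_mul hγ (hf.integrable hp) ht.1,
    memLp_oscOp hγ (hf.integrable hp) q⟩, ?_⟩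
  obtain ⟨A, hA, hup⟩ := exists_bestConst_le hγ
  have hκ := kernelLower_pos γ
  have upA : ∀ N : ℝ, 0 ≤ N → ∀ p q : ℝ≥0∞, 1 ≤ p → 1 ≤ q → expPoint p q ∈ regionA →
      bestConst γ N p q ≤ ENNReal.ofReal (A * (1 + N) ^ (-1 + recip p)) :=
    fun N hN p q hp hq h => hup N hN p p q hp hq le_rfl h.1 h.2.2.1
  have upB : ∀ N : ℝ, 0 ≤ N → ∀ p q : ℝ≥0∞, 1 ≤ p → 1 ≤ q → expPoint p q ∈ regionB →
      bestConst γ N p q ≤ ENNReal.ofReal (A * (1 + N) ^ (-recip q)) := by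
    rintro N hN p q hp hq ⟨-, h2, -, h4⟩
    simp only [expPoint] at h2 h4
    have hq1 : q⁻¹ ≤ 1 := ENNReal.inv_le_one.2 hq
    -- In region B the auxiliary exponent is the dual of `q`, written so that `q = ∞` gives `1` with
    -- no separate case.
    have hrec : recip (1 - q⁻¹)⁻¹ = 1 - recip q := by
      rw [recip, inv_inv, ENNReal.toReal_sub_of_le hq1 ENNReal.one_ne_top, ENNReal.toReal_one,
        recip]
    have hp' : 1 ≤ (1 - q⁻¹)⁻¹ := ENNReal.one_le_inv.2 tsub_le_self
    have := hup N hN p (1 - q⁻¹)⁻¹ q hp' hq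
      (le_of_recip_le_recip hp' hp (by rw [hrec]; exact h4)) (by rw [hrec]; linarith)
      (by rw [hrec]; linarith)
    rwa [hrec, show -1 + (1 - recip q) = -recip q by ring] at this
  have upC : ∀ N : ℝ, 0 ≤ N → ∀ p q : ℝ≥0∞, 1 ≤ p → 1 ≤ q → expPoint p q ∈ regionC →
      bestConst γ N p q ≤ ENNReal.ofReal (A * (1 + N) ^ (-(1 / 2 : ℝ))) := by
    rintro N hN p q hp hq ⟨-, h2, h3, -⟩
    simp only [expPoint] at h2 h3
    have hrec : recip 2 = 1 / 2 := by rw [recip_eq]; simp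
    have := hup N hN p 2 q one_le_two hq
      (le_of_recip_le_recip one_le_two hp (by rw [hrec]; exact h2)) (by rw [hrec])
      (by rw [hrec]; linarith)
    rwa [hrec, show (-1 + 1 / 2 : ℝ) = -(1 / 2) by norm_num] at this
  have hmax : ∀ a b e : ℝ, 0 ≤ e → a ≤ b → ENNReal.ofReal (a * e) ≤ ENNReal.ofReal (b * e) :=
    fun a b e he hab => ENNReal.ofReal_le_ofReal (mul_le_mul_of_nonneg_right hab he)
  refine ⟨⟨max A (kernelLower γ)⁻¹, max A (kernelLower γ)⁻¹, max A (kernelLower γ ^ 2 / 5)⁻¹,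
    lt_max_of_lt_left (by linarith), lt_max_of_lt_left (by linarith),
    lt_max_of_lt_left (by linarith), fun N hN p q hp hq => ?_⟩, A, by linarith,
    fun N hN p q hp hq => ?_⟩
  · have hpow : ∀ x : ℝ, 0 ≤ (1 + N) ^ x := fun x => Real.rpow_nonneg (by linarith) x
    have h1 : (max A (kernelLower γ)⁻¹)⁻¹ ≤ kernelLower γ :=
      inv_le_of_inv_le₀ hκ (le_max_right _ _)
    have h2 : (max A (kernelLower γ ^ 2 / 5)⁻¹)⁻¹ ≤ kernelLower γ ^ 2 / 5 :=
      inv_le_of_inv_le₀ (by positivity) (le_max_right _ _)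
    refine ⟨fun h => ⟨?_, ?_⟩, fun h => ⟨?_, ?_⟩, fun h => ⟨?_, ?_⟩⟩
    · exact (hmax _ _ _ (hpow _) h1).trans (le_bestConst_concentrated_input hγ hN hp hq)
    · exact (upA N hN p q hp hq h).trans (hmax _ _ _ (hpow _) (le_max_left _ _))
    · exact (hmax _ _ _ (hpow _) h1).trans (le_bestConst_concentrated_output hγ hN hp hq)
    · exact (upB N hN p q hp hq h).trans (hmax _ _ _ (hpow _) (le_max_left _ _))
    · exact (hmax _ _ _ (hpow _) h2).trans (le_bestConst_signs hγ hN hp hq)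
    · exact (upC N hN p q hp hq h).trans (hmax _ _ _ (hpow _) (le_max_left _ _))
  · have mono : ∀ x : ℝ, x ≤ -(min (1 - recip p) (min (recip q) (1 / 2))) →
        ENNReal.ofReal (A * (1 + N) ^ x) ≤
          ENNReal.ofReal (A * (1 + N) ^ (-(min (1 - recip p) (min (recip q) (1 / 2))))) :=
      fun x hx => ENNReal.ofReal_le_ofReal (mul_le_mul_of_nonneg_left
        (Real.rpow_le_rpow_of_exponent_le (by linarith) hx) (by linarith))
    have m1 : min (1 - recip p) (min (recip q) (1 / 2)) ≤ 1 - recip p := min_le_left _ _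
    have m2 : min (1 - recip p) (min (recip q) (1 / 2)) ≤ recip q :=
      (min_le_right _ _).trans (min_le_left _ _)
    have m3 : min (1 - recip p) (min (recip q) (1 / 2)) ≤ 1 / 2 :=
      (min_le_right _ _).trans (min_le_right _ _)
    have p0 := recip_nonneg p
    have q0 := recip_nonneg q
    have p1 := recip_le_one hp
    have q1 := recip_le_one hq
    -- The three regions cover the square, and in each the decay exponent is one of the three
    -- quantities in the minimum, hence at least the minimum.
    rcases le_or_gt (1 / 2) (recip p) with hx | hx
    · rcases le_or_gt (1 - recip p) (recip q) with hy | hy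
      · exact (upA N hN p q hp hq ⟨hx, p1, hy, q1⟩).trans (mono _ (by linarith))
      · refine (upB N hN p q hp hq ⟨q0, ?_, p0, ?_⟩).trans (mono _ (by linarith)) <;>
          simp only [expPoint] <;> linarith
    · rcases le_or_gt (1 / 2) (recip q) with hy | hy
      · exact (upC N hN p q hp hq ⟨p0, hx.le, hy, q1⟩).trans (mono _ (by linarith))
      · refine (upB N hN p q hp hq ⟨q0, hy.le, p0, ?_⟩).trans (mono _ (by linarith))
        simp only [expPoint]; linarith
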